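/- Graphs are finite and may have loops and multiple edges (a loop contributes $2$ to the degree of its vertex). For an integer $g\ge 0$, a surface of genus $g$ is a topological space homeomorphic to a sphere with $g$ handles attached (so it is compact, connected, orientable and without boundary). A graph is embeddable on a surface if it can be drawn on it without crossings: vertices are mapped to distinct points and each edge to a simple path (a simple closed curve for a loop) joining the images of its ends, whose interior meets no image of a vertex and no image of another edge. Let $\mathrm{tw}(P)$ denote the treewidth of $P$. There is a universal constant $c_{\mathrm{tw}}>0$ such that, for all integers $g\ge 0$ and $t\ge 48(g+1)$, there is a $4$-regular graph $P$ embeddable on a surface of genus $g$ such that $$|V(P)|\le \frac{t}{12}\qquad\text{and}\qquad \mathrm{tw}(P)\ge\max\bigl\{2,\;c_{\mathrm{tw}}\sqrt{gt+t}\bigr\}.$$ -/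

import Mathlib

/-! Graphs are Mathlib's multigraphs `Graph α β` (loops and parallel edges allowed). -/

namespace SurfaceGraph

/-! ### Degree and treewidth -/

/-- The degree of a vertex: the number of incident edge ends, so a loop counts twice. -/
noncomputable def degree {α β : Type*} (G : Graph α β) (v : α) : ℕ∞ :=
  {e | G.IsNonloopAt e v}.encard + 2 * {e | G.IsLoopAt e v}.encard

/-- `G` is `d`-regular: each of its vertices has degree `d`. -/
def IsRegularOfDegree {α β : Type*} (G : Graph α β) (d : ℕ) : Prop :=
  ∀ v ∈ G.vertexSet, degree G v = d

/-- A tree decomposition of the (finite) graph `G`. -/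
structure TreeDecomposition {α β : Type*} (G : Graph α β) where
  /-- the nodes of the tree -/
  node : Type
  finite_node : Finite node
  /-- the tree -/
  tree : SimpleGraph node
  isTree : tree.IsTree
  /-- the bags -/
  bag : node → Set α
  iUnion_bag : ⋃ i, bag i = G.vertexSet
  /-- both ends of each edge lie in a common bag -/
  exists_bag_of_isLink : ∀ e x y, G.IsLink e x y → ∃ i, x ∈ bag i ∧ y ∈ bag i
  /-- the nodes whose bags contain a given vertex span a connected subtree -/
  preconnected : ∀ v, (tree.induce {i | v ∈ bag i}).Preconnected

/-- The treewidth of a finite graph: the least `k` such that some tree decomposition has all its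
bags of size at most `k + 1`. -/
noncomputable def treewidth {α β : Type*} (G : Graph α β) : ℕ :=
  sInf {k : ℕ | ∃ D : TreeDecomposition G, ∀ i, (D.bag i).encard ≤ k + 1}

/-! ### The closed orientable surface of genus `g`: a sphere with `g` handles -/

/-- The data for attaching `g` handles to the Riemann sphere `ℂ ∪ {∞}`: for each `i : Fin g` two
closed disks, labelled `(i, false)` and `(i, true)`, all `2 * g` of them pairwise disjoint, and a
parameter `twist i` that says by which rotation the boundary circles of these two are glued. -/
structure Handles (g : ℕ) where
  center : Fin g × Bool → ℂ
  radius : Fin g × Bool → ℝ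
  radius_pos : ∀ k, 0 < radius k
  disjoint : ∀ k l, k ≠ l →
    Disjoint (Metric.closedBall (center k) (radius k)) (Metric.closedBall (center l) (radius l))
  twist : Fin g → ℂ
  norm_twist : ∀ i, ‖twist i‖ = radius (i, false) * radius (i, true)

namespace Handles

variable {g : ℕ} (h : Handles g)

/-- The sphere minus the `2 * g` open disks, as a subset of the Riemann sphere. -/
def holed : Set (OnePoint ℂ) :=
  (⋃ k, ((↑) : ℂ → OnePoint ℂ) '' Metric.ball (h.center k) (h.radius k))ᶜ

/-- The two boundary circles of the `i`-th handle are glued by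
`z ↦ center (i, true) + twist i / (z - center (i, false))`. This map takes the first circle onto
the second and reverses the orientation that they have as boundary curves of the holed sphere (it
extends to a Möbius map that takes the outside of the first circle to the inside of the second), so
the result is orientable. -/
def Glued (p q : h.holed) : Prop :=
  ∃ (i : Fin g) (z w : ℂ), (p : OnePoint ℂ) = z ∧ (q : OnePoint ℂ) = w ∧
    ‖z - h.center (i, false)‖ = h.radius (i, false) ∧
    ‖w - h.center (i, true)‖ = h.radius (i, true) ∧
    (z - h.center (i, false)) * (w - h.center (i, true)) = h.twist i

/-- The sphere with `g` handles, with the quotient topology. -/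
def Surface : Type := Quot h.Glued

instance : TopologicalSpace h.Surface :=
  inferInstanceAs (TopologicalSpace (Quot h.Glued))

end Handles

/-- `S` is a surface of genus `g` (compact, connected, orientable, without boundary): it is
homeomorphic to a sphere with `g` handles attached. The place where the handles are attached does
not matter up to homeomorphism. -/
def IsSurfaceOfGenus (g : ℕ) (S : Type*) [TopologicalSpace S] : Prop :=
  ∃ h : Handles g, Nonempty (S ≃ₜ h.Surface)

/-! ### Embeddings -/

/-- An embedding (crossing-free drawing) of `G` on the space `S`. Only the values of `point` on the
vertices and of `arc` on the edges of `G` are relevant. -/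
structure Embedding {α β : Type*} (G : Graph α β) (S : Type*) [TopologicalSpace S] where
  /-- the images of the vertices -/
  point : α → S
  /-- the images of the edges -/
  arc : β → C(unitInterval, S)
  /-- the images of the vertices are pairwise distinct -/
  injOn_point : Set.InjOn point G.vertexSet
  /-- each edge is drawn as a path between the images of its ends -/
  arc_ends : ∀ e ∈ G.edgeSet, ∃ x y, G.IsLink e x y ∧ arc e 0 = point x ∧ arc e 1 = point y
  /-- the path is simple, except that the two endpoints agree for a loop -/
  arc_simple : ∀ e ∈ G.edgeSet, ∀ s t, arc e s = arc e t →
    s = t ∨ ((s = 0 ∨ s = 1) ∧ (t = 0 ∨ t = 1))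
  /-- the interior of an edge meets no vertex -/
  arc_ne_point : ∀ e ∈ G.edgeSet, ∀ v ∈ G.vertexSet, ∀ s, s ≠ 0 → s ≠ 1 → arc e s ≠ point v
  /-- the interior of an edge meets no other edge -/
  arc_ne_arc : ∀ e ∈ G.edgeSet, ∀ f ∈ G.edgeSet, e ≠ f → ∀ s t, s ≠ 0 → s ≠ 1 →
    arc e s ≠ arc f t

/-- `G` is embeddable on a surface of genus `g`. -/
def EmbeddableOnGenus {α β : Type*} (G : Graph α β) (g : ℕ) : Prop :=
  ∃ (S : Type) (_ : TopologicalSpace S), IsSurfaceOfGenus g S ∧ Nonempty (Embedding G S)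

end SurfaceGraph

namespace SurfaceGraph

open Relation

/-! ### Treewidth lower bounds -/

/-! The graph is a grid with `k` rows and `(2h+1)k` columns, `h ≤ g`, the columns coming in groups
of `k`. At the border the loose ends of rows and columns are joined in consecutive pairs, which
gives degree 4; below the first `2h` groups, the ends are instead joined group to group by bundles
of `k` edges. The grid is planar and each bundle takes one handle, so any matching `σ` of even
groups to odd groups can be drawn (`embeddableOnGenus_graph`).

For large genus, 40 consecutive groups are merged into a block, giving `m` blocks with `m` of order
`g`, and `σ` is chosen so that the blocks form an expander; 20 random permutations of the blocks
suffice by a union bound (`exists_expanding_perms`). In a block, row `a` and the columns of label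
`a` form a connected cross. Crosses of one block meet, crosses of equal label in linked blocks are
adjacent, and a vertex lies in at most two crosses. So deleting at most `mk/64` vertices leaves 7/8
of the blocks with more than 3/4 of their crosses intact, and by expansion more than half of all
blocks stay linked together. Any two such linked remainders intersect, so they form a bramble, and
the treewidth is at least `⌊mk/64⌋` (`le_treewidth_of_expanding`).

With `mk²` of order `t` and `m` of order `g + 1`, the product `mk` has order `√((g+1)t)`. If
`(g+1)t` is bounded, a grid on four vertices suffices. -/

/-- The vertex set `S` induces a connected subgraph of `G` (or is empty). -/
def ConnectedOn {α β : Type*} (G : Graph α β) (S : Set α) : Prop :=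
  ∀ u ∈ S, ∀ v ∈ S, ReflTransGen (fun a b ↦ b ∈ S ∧ G.Adj a b) u v

/-- Two vertex sets touch: they share a vertex or are joined by an edge. -/
def Touching {α β : Type*} (G : Graph α β) (S T : Set α) : Prop :=
  ∃ u ∈ S, ∃ v ∈ T, u = v ∨ G.Adj u v

namespace TreeDecomposition

variable {α β : Type*} {G : Graph α β} (D : TreeDecomposition G)

lemma reachable_of_mem_bag {i j p q : D.node} {u : α} (hi : u ∉ D.bag i)
    (hp : u ∈ D.bag p) (hq : u ∈ D.bag q) :
    (D.tree.deleteEdges {s(i, j)}).Reachable p q := by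
  have h := D.preconnected u ⟨p, hp⟩ ⟨q, hq⟩
  let f : D.tree.induce {i | u ∈ D.bag i} →g D.tree.deleteEdges {s(i, j)} :=
    { toFun := Subtype.val
      map_rel' := by
        rintro ⟨a, ha⟩ ⟨b, hb⟩ hab
        rw [SimpleGraph.deleteEdges_adj]
        refine ⟨hab, fun hs ↦ ?_⟩
        rcases Sym2.eq_iff.1 (Set.mem_singleton_iff.1 hs) with ⟨rfl, -⟩ | ⟨-, rfl⟩
        · exact hi ha
        · exact hi hb }
  exact h.map f

lemma reachable_of_adj {i j p q : D.node} {u v : α} (hu : u ∉ D.bag i) (hv : v ∉ D.bag i)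
    (huv : u = v ∨ G.Adj u v) (hp : u ∈ D.bag p) (hq : v ∈ D.bag q) :
    (D.tree.deleteEdges {s(i, j)}).Reachable p q := by
  rcases huv with rfl | ⟨e, he⟩
  · exact D.reachable_of_mem_bag hu hp hq
  · obtain ⟨n, hn, hn'⟩ := D.exists_bag_of_isLink e u v he
    exact (D.reachable_of_mem_bag hu hp hn).trans (D.reachable_of_mem_bag hv hn' hq)

lemma exists_mem_bag {v : α} (hv : v ∈ G.vertexSet) : ∃ p, v ∈ D.bag p := by
  rw [← D.iUnion_bag] at hv
  simpa using hv

/-- Moving along a path in `S`, consecutive vertices share a bag, and the subtree of each vertex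
avoids node `i`; hence the edge at `i` is never used. -/
lemma reachable_of_connectedOn {S : Set α} (hS : ConnectedOn G S) {i j p q : D.node}
    (hi : Disjoint (D.bag i) S) {u v : α} (hu : u ∈ S) (hv : v ∈ S) (hp : u ∈ D.bag p)
    (hq : v ∈ D.bag q) : (D.tree.deleteEdges {s(i, j)}).Reachable p q := by
  have hn : ∀ w ∈ S, w ∉ D.bag i := fun w hw hw' ↦ Set.disjoint_left.1 hi hw' hw
  have h := hS u hu v hv
  clear hv
  induction h generalizing q with
  | refl => exact D.reachable_of_mem_bag (hn u hu) hp hq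
  | @tail b c hab hbc ih =>
    obtain ⟨r, hr⟩ := D.exists_mem_bag hbc.2.left_mem
    have hb : b ∈ S := by
      rcases hab.cases_tail with rfl | ⟨_, _, h⟩
      · exact hu
      · exact h.1
    exact (ih hr).trans (D.reachable_of_adj (hn b hb) (hn c hbc.1) (.inr hbc.2) hr hq)

/-- In a tree decomposition, it is impossible to choose for every bag a connected vertex set that
misses the bag, so that the chosen sets pairwise touch. -/
theorem not_forall_disjoint_bag (C : D.node → Set α) (hV : ∀ i, C i ⊆ G.vertexSet)
    (hne : ∀ i, (C i).Nonempty) (hC : ∀ i, ConnectedOn G (C i))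
    (hdisj : ∀ i, Disjoint (D.bag i) (C i)) (htouch : ∀ i j, Touching G (C i) (C j)) : False := by
  classical
  have := D.finite_node
  have := Fintype.ofFinite D.node
  -- Each node points to its neighbour in the direction of a bag that meets its chosen set.
  have key : ∀ i, ∃ j, D.tree.Adj i j ∧ ∃ n, (∃ u ∈ C i, u ∈ D.bag n) ∧
      (D.tree.deleteEdges {s(i, j)}).Reachable j n := by
    intro i
    obtain ⟨u, hu⟩ := hne i
    obtain ⟨n, hn⟩ := D.exists_mem_bag (hV i hu)
    obtain ⟨p, hp⟩ := (D.isTree.existsUnique_path i n).exists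
    cases p with
    | nil => exact (Set.disjoint_left.1 (hdisj i) hn hu).elim
    | @cons _ j _ h p =>
      rw [SimpleGraph.Walk.cons_isPath_iff] at hp
      refine ⟨j, h, n, ⟨u, hu, hn⟩, ⟨p.toDeleteEdges _ fun e he hs ↦ ?_⟩⟩
      rw [Set.mem_singleton_iff.1 hs] at he
      exact hp.2 (p.fst_mem_support_of_mem_edges he)
  choose f hf n hn hr using key
  -- A tree has fewer edges than nodes, so two nodes select the same edge and point at each other.
  have hcard := D.isTree.card_edgeFinset
  obtain ⟨i, -, j, -, hij, heq⟩ := Finset.exists_ne_map_eq_of_card_lt_of_maps_to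
    (s := Finset.univ) (t := D.tree.edgeFinset) (f := fun i ↦ s(i, f i))
    (by rw [Finset.card_univ]; omega) (fun i _ ↦ by simpa using hf i)
  obtain ⟨h1, h2⟩ : i = f j ∧ f i = j := by
    rcases Sym2.eq_iff.1 heq with ⟨h, -⟩ | h
    · exact (hij h).elim
    · exact h
  have hri := hr i
  have hrj := hr j
  rw [← h1, Sym2.eq_swap] at hrj
  rw [h2] at hri
  -- This edge is a bridge, yet the two sets, lying on opposite sides and touching in a common bag,
  -- connect its ends without it.
  have hb := SimpleGraph.isAcyclic_iff_forall_adj_isBridge.1 D.isTree.isAcyclic (h2 ▸ hf i)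
  rw [SimpleGraph.isBridge_iff] at hb
  apply hb
  obtain ⟨u, hu, hun⟩ := hn i
  obtain ⟨v, hv, hvn⟩ := hn j
  obtain ⟨x, hx, y, hy, hxy⟩ := htouch i j
  obtain ⟨r, hr1, hr2⟩ : ∃ r, (∃ x ∈ C i, x ∈ D.bag r) ∧ ∃ y ∈ C j, y ∈ D.bag r := by
    rcases hxy with rfl | ⟨e, he⟩
    · obtain ⟨r, hr⟩ := D.exists_mem_bag (hV i hx)
      exact ⟨r, ⟨x, hx, hr⟩, x, hy, hr⟩
    · obtain ⟨r, h, h'⟩ := D.exists_bag_of_isLink e x y he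
      exact ⟨r, ⟨x, hx, h⟩, y, hy, h'⟩
  obtain ⟨x, hx, hxr⟩ := hr1
  obtain ⟨y, hy, hyr⟩ := hr2
  have a1 := D.reachable_of_connectedOn (j := j) (hC i) (hdisj i) hu hx hun hxr
  have a2 := D.reachable_of_connectedOn (j := i) (hC j) (hdisj j) hv hy hvn hyr
  rw [Sym2.eq_swap] at a2
  exact hrj.trans (a2.trans (a1.symm.trans hri.symm))

end TreeDecomposition

/-- If every set of at most `s` vertices misses a connected set, so that these connected sets
pairwise touch, then the treewidth is at least `s`. -/
theorem le_treewidth {α β : Type*} {G : Graph α β} (hfin : G.vertexSet.Finite) (s : ℕ)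
    (C : Set α → Set α)
    (hC : ∀ X ⊆ G.vertexSet, X.encard ≤ s → C X ⊆ G.vertexSet ∧ (C X).Nonempty ∧
      ConnectedOn G (C X) ∧ Disjoint X (C X))
    (htouch : ∀ X ⊆ G.vertexSet, ∀ Y ⊆ G.vertexSet, X.encard ≤ s → Y.encard ≤ s →
      Touching G (C X) (C Y)) : s ≤ treewidth G := by
  -- The decomposition with a single bag shows that the infimum is taken over a nonempty set and is
  -- therefore attained.
  have hmem : treewidth G ∈ {k : ℕ | ∃ D : TreeDecomposition G, ∀ i, (D.bag i).encard ≤ k + 1} := by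
    apply Nat.sInf_mem
    refine ⟨G.vertexSet.ncard, ⟨Unit, inferInstance, ⊥, SimpleGraph.IsTree.of_subsingleton,
      fun _ ↦ G.vertexSet, Set.iUnion_const _, fun e x y h ↦ ⟨(), h.left_mem, h.right_mem⟩,
      fun v ↦ ?_⟩, fun _ ↦ ?_⟩
    · rintro ⟨⟨⟩, h⟩ ⟨⟨⟩, h'⟩
      exact .refl _
    · rw [← hfin.cast_ncard_eq]
      exact le_self_add
  obtain ⟨D, hD⟩ := hmem
  by_contra! hlt
  have hcard : ∀ i, (D.bag i).encard ≤ s := fun i ↦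
    (hD i).trans (by exact_mod_cast hlt)
  have hsub : ∀ i, D.bag i ⊆ G.vertexSet := fun i ↦ D.iUnion_bag ▸ Set.subset_iUnion D.bag i
  have h := fun i ↦ hC _ (hsub i) (hcard i)
  exact D.not_forall_disjoint_bag (fun i ↦ C (D.bag i)) (fun i ↦ (h i).1) (fun i ↦ (h i).2.1)
    (fun i ↦ (h i).2.2.1) (fun i ↦ (h i).2.2.2)
    (fun i j ↦ htouch _ (hsub i) _ (hsub j) (hcard i) (hcard j))

variable {α β : Type*} {G : Graph α β}

lemma ConnectedOn.biUnion {ι : Type*} {P : Set ι} {T : ι → Set α}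
    (hT : ∀ i ∈ P, ConnectedOn G (T i))
    (hP : ∀ i ∈ P, ∀ j ∈ P, ReflTransGen (fun i j ↦ j ∈ P ∧ Touching G (T i) (T j)) i j) :
    ConnectedOn G (⋃ i ∈ P, T i) := by
  intro u hu v hv
  obtain ⟨i, hi, hu⟩ := Set.mem_iUnion₂.1 hu
  obtain ⟨j, hj, hvj⟩ := Set.mem_iUnion₂.1 hv
  clear hv
  have hsub : ∀ i ∈ P, ∀ a ∈ T i, ∀ b ∈ T i,
      ReflTransGen (fun a b ↦ b ∈ (⋃ i ∈ P, T i) ∧ G.Adj a b) a b := fun i hi a ha b hb ↦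
    ReflTransGen.mono (fun x y h ↦ ⟨Set.mem_iUnion₂.2 ⟨i, hi, h.1⟩, h.2⟩) _ _ (hT i hi a ha b hb)
  have h := hP i hi j hj
  clear hj
  induction h generalizing v with
  | refl => exact hsub i hi u hu v hvj
  | @tail b c hab hbc ih =>
    obtain ⟨hc, x, hx, y, hy, hxy⟩ := hbc
    have h1 := ih x hx
    have h3 := hsub c hc y hy v hvj
    rcases hxy with rfl | hxy
    · exact h1.trans h3
    · exact (h1.tail ⟨Set.mem_iUnion₂.2 ⟨c, hc, hy⟩, hxy⟩).trans h3

/-- In a set of at least seven eighths of `m` points, an equivalence relation that relates any two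
disjoint subsets of at least a quarter of `m` points has a class of more than half of `m` points. -/
lemma exists_large_class {ι : Type*} [DecidableEq ι] {m : ℕ} (hm : 0 < m) {U : Finset ι}
    (hU : 7 * m ≤ 8 * U.card) (r : Setoid ι) [DecidableRel r]
    (hexp : ∀ A ⊆ U, ∀ B ⊆ U, Disjoint A B → m ≤ 4 * A.card → m ≤ 4 * B.card →
      ∃ v ∈ A, ∃ w ∈ B, r v w) :
    ∃ v ∈ U, m < 2 * (U.filter (r v)).card := by
  by_contra! hcon
  -- Unions of classes with at least `m / 4` elements. A smallest one has at most `m / 2` elements: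
  -- it is a single class, or it loses that property when a class with fewer than `m / 4` elements
  -- is removed.
  let S : Finset (Finset ι) := U.powerset.filter fun A ↦
    (∀ a ∈ A, ∀ b ∈ U, r a b → b ∈ A) ∧ m ≤ 4 * A.card
  have hS : ∀ A, A ∈ S ↔ A ⊆ U ∧ (∀ a ∈ A, ∀ b ∈ U, r a b → b ∈ A) ∧ m ≤ 4 * A.card := by
    simp [S]
  have hUS : U ∈ S := (hS U).2 ⟨subset_rfl, fun _ _ b hb _ ↦ hb, by omega⟩
  obtain ⟨A, hA, hmin⟩ := S.exists_min_image Finset.card ⟨U, hUS⟩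
  obtain ⟨hAU, hclosed, hAm⟩ := (hS A).1 hA
  have hAne : A.Nonempty := Finset.card_pos.1 (by omega)
  obtain ⟨a, ha⟩ := hAne
  have haU := hAU ha
  have hC := hcon a haU
  set C := U.filter (r a) with hCdef
  have hCA : C ⊆ A := fun b hb ↦ by
    rw [hCdef, Finset.mem_filter] at hb
    exact hclosed a ha b hb.1 hb.2
  have haC : a ∈ C := Finset.mem_filter.2 ⟨haU, r.refl a⟩
  have hA2 : 2 * A.card ≤ m := by
    by_cases h4 : m ≤ 4 * C.card
    · have := hmin C ((hS C).2 ⟨Finset.filter_subset _ _, fun b hb c hc hbc ↦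
        Finset.mem_filter.2 ⟨hc, r.trans (Finset.mem_filter.1 hb).2 hbc⟩, h4⟩)
      omega
    · have hcard := Finset.card_sdiff_add_card_eq_card hCA
      have hCpos : 0 < C.card := Finset.card_pos.2 ⟨a, haC⟩
      by_contra h2
      have := hmin (A \ C) ((hS _).2 ⟨Finset.sdiff_subset.trans hAU, fun b hb c hc hbc ↦ by
        rw [Finset.mem_sdiff] at hb ⊢
        refine ⟨hclosed b hb.1 c hc hbc, fun hcC ↦ hb.2 (Finset.mem_filter.2 ⟨hAU hb.1, ?_⟩)⟩
        exact r.trans (Finset.mem_filter.1 hcC).2 (r.symm hbc), by omega⟩)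
      omega
  -- The complement in `U` still has at least `7m/8 - m/2 = 3m/8` elements, so expansion contradicts
  -- closedness.
  have hcard := Finset.card_sdiff_add_card_eq_card hAU
  obtain ⟨v, hv, w, hw, hvw⟩ := hexp A hAU (U \ A) Finset.sdiff_subset
    Finset.disjoint_sdiff hAm (by omega)
  rw [Finset.mem_sdiff] at hw
  exact hw.2 (hclosed v hv w hw.1 hvw)

/-- A relation `R` on `{0, …, m - 1}` is expanding if it has a pair in `A × B` for any two disjoint
sets `A` and `B` of at least `m / 4` elements. -/
def Expanding (m : ℕ) (R : ℕ → ℕ → Prop) : Prop :=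
  ∀ A ⊆ Finset.range m, ∀ B ⊆ Finset.range m, Disjoint A B → m ≤ 4 * A.card → m ≤ 4 * B.card →
    ∃ v ∈ A, ∃ w ∈ B, R v w

/-- Lower bound for the treewidth of a graph in which each `v < m` is represented by `k` pairwise
intersecting connected sets `L v a`, with `L v a` touching `L w a` for each pair `(v, w)` of an
expanding relation. -/
theorem le_treewidth_of_expanding (hfin : G.vertexSet.Finite) {m k : ℕ} (hm : 0 < m) (hk : 0 < k)
    {L : ℕ → ℕ → Set α} (hV : ∀ v < m, ∀ a < k, L v a ⊆ G.vertexSet)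
    (hconn : ∀ v < m, ∀ a < k, ConnectedOn G (L v a))
    (hcross : ∀ v < m, ∀ a < k, ∀ b < k, (L v a ∩ L v b).Nonempty)
    {f₁ f₂ : α → ℕ × ℕ} (hf : ∀ v a x, x ∈ L v a → (v, a) = f₁ x ∨ (v, a) = f₂ x)
    {R : ℕ → ℕ → Prop}
    (hR : ∀ v < m, ∀ w < m, R v w → ∀ a < k, Touching G (L v a) (L w a))
    (hexp : Expanding m R) {s : ℕ} (hs : 64 * s ≤ m * k) : s ≤ treewidth G := by
  classical
  let hit : Set α → ℕ → Finset ℕ := fun X v ↦ {a ∈ Finset.range k | (X ∩ L v a).Nonempty}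
  let good : Set α → Finset ℕ := fun X ↦ {v ∈ Finset.range m | 4 * (hit X v).card < k}
  have hgoodm : ∀ X v, v ∈ good X → v < m := fun X v hv ↦
    Finset.mem_range.1 (Finset.mem_filter.1 hv).1
  have hcommon : ∀ X Y v w, v ∈ good X → w ∈ good Y → ∃ a < k, a ∉ hit X v ∧ a ∉ hit Y w := by
    intro X Y v w hv hw
    have h1 := (Finset.mem_filter.1 hv).2
    have h2 := (Finset.mem_filter.1 hw).2
    have h3 : (hit X v ∪ hit Y w).card < (Finset.range k).card := by
      rw [Finset.card_range]
      have := Finset.card_union_le (hit X v) (hit Y w)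
      omega
    obtain ⟨a, ha, ha'⟩ := Finset.exists_mem_notMem_of_card_lt_card h3
    rw [Finset.notMem_union] at ha'
    exact ⟨a, Finset.mem_range.1 ha, ha'⟩
  have hgood : ∀ X : Set α, X.encard ≤ s → 7 * m ≤ 8 * (good X).card := by
    intro X hX
    have hXfin : X.Finite := Set.finite_of_encard_le_coe hX
    lift X to Finset α using hXfin
    rw [Set.encard_coe_eq_coe_finsetCard, Nat.cast_le] at hX
    -- Each vertex of `X` lies in at most two of the sets, those with indices `f₁ x` and `f₂ x`.
    have hsum : ∑ v ∈ Finset.range m, (hit X v).card ≤ 2 * s := by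
      rw [← Finset.card_sigma]
      have h1 : ((Finset.range m).sigma (hit X)).card ≤ (X.image f₁ ∪ X.image f₂).card := by
        refine Finset.card_le_card_of_injOn (fun p ↦ (p.1, p.2)) ?_ ?_
        · rintro ⟨v, a⟩ h
          rw [Finset.mem_coe, Finset.mem_sigma] at h
          obtain ⟨x, hx, hxL⟩ := (Finset.mem_filter.1 h.2).2
          rw [Finset.mem_coe, Finset.mem_union, Finset.mem_image, Finset.mem_image]
          exact (hf v a x hxL).imp (fun h ↦ ⟨x, hx, h.symm⟩) (fun h ↦ ⟨x, hx, h.symm⟩)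
        · rintro ⟨v, a⟩ - ⟨w, b⟩ - h
          obtain ⟨rfl, rfl⟩ := Prod.mk.inj h
          rfl
      have h2 := Finset.card_union_le (X.image f₁) (X.image f₂)
      have h3 := Finset.card_image_le (s := X) (f := f₁)
      have h4 := Finset.card_image_le (s := X) (f := f₂)
      omega
    -- Each bad index accounts for at least `k / 4` of the at most `2 * s` sets that are hit.
    have hbad : k * ((Finset.range m).filter fun v ↦ ¬ 4 * (hit X v).card < k).card ≤ 8 * s := by
      calc k * ((Finset.range m).filter fun v ↦ ¬ 4 * (hit X v).card < k).card
          = ∑ v ∈ (Finset.range m).filter fun v ↦ ¬ 4 * (hit X v).card < k, k := by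
            rw [Finset.sum_const, smul_eq_mul, mul_comm]
        _ ≤ ∑ v ∈ (Finset.range m).filter fun v ↦ ¬ 4 * (hit X v).card < k,
              4 * (hit X v).card :=
            Finset.sum_le_sum fun v hv ↦ not_lt.1 (Finset.mem_filter.1 hv).2
        _ ≤ ∑ v ∈ Finset.range m, 4 * (hit X v).card :=
            Finset.sum_le_sum_of_subset (Finset.filter_subset _ _)
        _ ≤ 8 * s := by rw [← Finset.mul_sum]; omega
    have hadd := Finset.card_filter_add_card_filter_not (s := Finset.range m)
      (fun v ↦ 4 * (hit X v).card < k)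
    rw [Finset.card_range] at hadd
    have h8 : 8 * ((Finset.range m).filter fun v ↦ ¬ 4 * (hit X v).card < k).card ≤ m :=
      Nat.le_of_mul_le_mul_right (c := k) (by nlinarith) hk
    change 7 * m ≤ 8 * ((Finset.range m).filter fun v ↦ 4 * (hit X v).card < k).card
    omega
  -- The unhit sets over a large component of good indices form the bramble element for `X`.
  have key : ∀ X : Set α, X.encard ≤ s → ∃ K ⊆ good X, m < 2 * K.card ∧
      ConnectedOn G (⋃ p ∈ {p : ℕ × ℕ | p.1 ∈ K ∧ p.2 < k ∧ p.2 ∉ hit X p.1}, L p.1 p.2) := by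
    intro X hX
    let E : ℕ → ℕ → Prop := fun v w ↦ v ∈ good X ∧ w ∈ good X ∧ (R v w ∨ R w v)
    have hEsymm : Std.Symm E := ⟨fun v w h ↦ ⟨h.2.1, h.1, h.2.2.symm⟩⟩
    let r : Setoid ℕ := ⟨ReflTransGen E, fun _ ↦ .refl,
      fun h ↦ symm_of (ReflTransGen E) h, fun h h' ↦ h.trans h'⟩
    have hrange : good X ⊆ Finset.range m := Finset.filter_subset _ _
    obtain ⟨v₀, hv₀, hlarge⟩ := exists_large_class hm (hgood X hX) r
      (fun A hA B hB hAB hAm hBm ↦ by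
        obtain ⟨v, hv, w, hw, hvw⟩ := hexp A (hA.trans hrange) B (hB.trans hrange) hAB hAm hBm
        exact ⟨v, hv, w, hw, .single ⟨hA hv, hB hw, .inl hvw⟩⟩)
    set K := (good X).filter (r v₀) with hK
    refine ⟨K, Finset.filter_subset _ _, hlarge, ConnectedOn.biUnion ?_ ?_⟩
    · rintro ⟨v, a⟩ ⟨hv, ha, -⟩
      exact hconn v (hgoodm X v (Finset.mem_filter.1 hv).1) a ha
    · rintro ⟨v, a⟩ ⟨hv, ha, hav⟩ ⟨w, b⟩ ⟨hw, hb, hbw⟩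
      obtain ⟨hvg, hv'⟩ := Finset.mem_filter.1 hv
      obtain ⟨hwg, hw'⟩ := Finset.mem_filter.1 hw
      have hvw : ReflTransGen E v w := r.trans (r.symm hv') hw'
      dsimp only at hb hbw
      clear hw hw' hwg
      have hsame : ∀ u ∈ good X, ∀ a < k, ∀ b < k, Touching G (L u a) (L u b) := by
        intro u hu a ha b hb
        obtain ⟨x, hx, hx'⟩ := hcross u (hgoodm X u hu) a ha b hb
        exact ⟨x, hx, x, hx', .inl rfl⟩
      induction hvw generalizing b with
      | refl => exact .single ⟨⟨hv, hb, hbw⟩, hsame v hvg a ha b hb⟩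
      | @tail c w hvc hcw ih =>
        obtain ⟨hc, hw, hRR⟩ := hcw
        -- To pass from `c` to `w`, switch to a label `d` that is unhit at both, follow the link,
        -- then switch to `b` inside `w`.
        obtain ⟨d, hd, hdc, hdw⟩ := hcommon X X c w hc hw
        have hwK : w ∈ K := Finset.mem_filter.2 ⟨hw, hv'.trans (hvc.tail ⟨hc, hw, hRR⟩)⟩
        refine ((ih d hd hdc).tail (c := (w, d)) ⟨⟨hwK, hd, hdw⟩, ?_⟩).tail
          ⟨⟨hwK, hb, hbw⟩, hsame w hw d hd b hb⟩
        rcases hRR with h | h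
        · exact hR c (hgoodm X c hc) w (hgoodm X w hw) h d hd
        · obtain ⟨x, hx, y, hy, hxy⟩ := hR w (hgoodm X w hw) c (hgoodm X c hc) h d hd
          exact ⟨y, hy, x, hx, hxy.imp Eq.symm fun h ↦ h.symm⟩
  choose! K hKgood hKcard hKconn using key
  -- Two sets of more than half of the indices overlap, and at a common good index some label is
  -- unhit by both `X` and `Y`.
  have hshare : ∀ X Y : Set α, X.encard ≤ s → Y.encard ≤ s →
      ∃ v < m, ∃ a < k, (v ∈ K X ∧ a ∉ hit X v) ∧ v ∈ K Y ∧ a ∉ hit Y v := by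
    intro X Y hX hY
    have hsub : K X ∪ K Y ⊆ Finset.range m :=
      Finset.union_subset ((hKgood X hX).trans (Finset.filter_subset _ _))
        ((hKgood Y hY).trans (Finset.filter_subset _ _))
    have h1 := Finset.card_le_card hsub
    rw [Finset.card_range] at h1
    have h2 := Finset.card_union_add_card_inter (K X) (K Y)
    have h3 := hKcard X hX
    have h4 := hKcard Y hY
    obtain ⟨v, hv⟩ := Finset.card_pos.1 (show 0 < (K X ∩ K Y).card by omega)
    rw [Finset.mem_inter] at hv
    obtain ⟨a, ha, haX, haY⟩ := hcommon X Y v v (hKgood X hX hv.1) (hKgood Y hY hv.2)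
    exact ⟨v, hgoodm X v (hKgood X hX hv.1), a, ha, ⟨hv.1, haX⟩, hv.2, haY⟩
  let C : Set α → Set α := fun X ↦
    ⋃ p ∈ {p : ℕ × ℕ | p.1 ∈ K X ∧ p.2 < k ∧ p.2 ∉ hit X p.1}, L p.1 p.2
  have hmemC : ∀ X v a, v ∈ K X → a < k → a ∉ hit X v → L v a ⊆ C X := fun X v a hv ha hh x hx ↦
    Set.mem_iUnion₂.2 ⟨(v, a), ⟨hv, ha, hh⟩, hx⟩
  have hshareC : ∀ X Y : Set α, X.encard ≤ s → Y.encard ≤ s → (C X ∩ C Y).Nonempty := by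
    intro X Y hX hY
    obtain ⟨v, hv, a, ha, h1, h2⟩ := hshare X Y hX hY
    obtain ⟨x, hx, -⟩ := hcross v hv a ha a ha
    exact ⟨x, hmemC X v a h1.1 ha h1.2 hx, hmemC Y v a h2.1 ha h2.2 hx⟩
  refine le_treewidth hfin s C (fun X _ hX ↦ ⟨?_, ?_, hKconn X hX, ?_⟩) ?_
  · refine Set.iUnion₂_subset ?_
    rintro ⟨v, a⟩ ⟨hv, ha, -⟩
    exact hV v (hgoodm X v (hKgood X hX hv)) a ha
  · exact (hshareC X X hX hX).mono Set.inter_subset_left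
  · rw [Set.disjoint_left]
    intro x hxX hxC
    obtain ⟨⟨v, a⟩, ⟨-, ha, hh⟩, hx⟩ := Set.mem_iUnion₂.1 hxC
    exact hh (Finset.mem_filter.2 ⟨Finset.mem_range.2 ha, x, hxX, hx⟩)
  · intro X _ Y _ hX hY
    obtain ⟨x, hx, hy⟩ := hshareC X Y hX hY
    exact ⟨x, hx, x, hy, .inl rfl⟩

/-! ### Existence of expanding matchings -/

open Finset in
-- Double counting of pairs `(y, π)` with `y ∉ A`, where `π` maps `A` and `y` into `C`. Each `π` has
-- `#C - #A` choices of `y`; each `y` can be exchanged for `x` by composing with a transposition.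
lemma card_compl_mul_card_perm_insert {V : Type*} [Fintype V] [DecidableEq V] (A C : Finset V)
    {x : V} (hx : x ∉ A) :
    #Aᶜ * #{π : Equiv.Perm V | ∀ a ∈ insert x A, π a ∈ C} =
      (#C - #A) * #{π : Equiv.Perm V | ∀ a ∈ A, π a ∈ C} := by
  have h := sum_card_bipartiteAbove_eq_sum_card_bipartiteBelow (s := Aᶜ)
    (t := ({π : Equiv.Perm V | ∀ a ∈ A, π a ∈ C} : Finset (Equiv.Perm V)))
    (fun y π ↦ π y ∈ C)
  have hbelow : ∀ π ∈ ({π : Equiv.Perm V | ∀ a ∈ A, π a ∈ C} : Finset (Equiv.Perm V)),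
      #(bipartiteBelow (fun y (π : Equiv.Perm V) ↦ π y ∈ C) Aᶜ π) = #C - #A := by
    intro π hπ
    have hsub : A ⊆ C.map π.symm.toEmbedding := fun a ha ↦ by
      rw [mem_map_equiv]
      simpa using (mem_filter.1 hπ).2 a ha
    have : bipartiteBelow (fun y (π : Equiv.Perm V) ↦ π y ∈ C) Aᶜ π =
        C.map π.symm.toEmbedding \ A := by
      ext y
      rw [mem_bipartiteBelow, mem_sdiff, mem_map_equiv, mem_compl]
      simp [and_comm]
    rw [this, card_sdiff_of_subset hsub, card_map]
  have habove : ∀ y ∈ Aᶜ, #(bipartiteAbove (fun y (π : Equiv.Perm V) ↦ π y ∈ C)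
      ({π : Equiv.Perm V | ∀ a ∈ A, π a ∈ C} : Finset (Equiv.Perm V)) y) =
      #{π : Equiv.Perm V | ∀ a ∈ insert x A, π a ∈ C} := by
    intro y hy
    rw [mem_compl] at hy
    refine card_bij (fun π _ ↦ π * Equiv.swap x y) ?_ ?_ ?_
    · intro π hπ
      rw [mem_bipartiteAbove, mem_filter] at hπ
      refine mem_filter.2 ⟨mem_univ _, fun a ha ↦ ?_⟩
      rcases mem_insert.1 ha with rfl | ha
      · simpa using hπ.2
      · have h1 : a ≠ x := fun h ↦ hx (h ▸ ha)
        have h2 : a ≠ y := fun h ↦ hy (h ▸ ha)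
        simpa [Equiv.swap_apply_of_ne_of_ne h1 h2] using hπ.1.2 a ha
    · intro π _ π' _ h
      simpa using h
    · intro π hπ
      have hπ := (mem_filter.1 hπ).2
      refine ⟨π * Equiv.swap x y, ?_, by simp [mul_assoc]⟩
      rw [mem_bipartiteAbove, mem_filter]
      refine ⟨⟨mem_univ _, fun a ha ↦ ?_⟩, by simpa using hπ x (mem_insert_self _ _)⟩
      have h1 : a ≠ x := fun h ↦ hx (h ▸ ha)
      have h2 : a ≠ y := fun h ↦ hy (h ▸ ha)
      simpa [Equiv.swap_apply_of_ne_of_ne h1 h2] using hπ a (mem_insert_of_mem ha)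
  rwa [sum_congr rfl habove, sum_congr rfl hbelow, sum_const, sum_const, smul_eq_mul, smul_eq_mul,
    mul_comm (#{π : Equiv.Perm V | ∀ a ∈ A, π a ∈ C}) (#C - #A)] at h

open Finset in
/-- At most a fraction `(|C| / |V|) ^ |A|` of the permutations of `V` map `A` into `C`. -/
lemma card_pow_mul_card_perm_le {V : Type*} [Fintype V] [DecidableEq V] (A C : Finset V) :
    Fintype.card V ^ #A * #{π : Equiv.Perm V | ∀ a ∈ A, π a ∈ C} ≤
      #C ^ #A * (Fintype.card V).factorial := by
  induction A using Finset.induction_on with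
  | empty => simp [Fintype.card_perm]
  | insert x A hx ih =>
    have h := card_compl_mul_card_perm_insert A C hx
    set f := #{π : Equiv.Perm V | ∀ a ∈ A, π a ∈ C}
    set f' := #{π : Equiv.Perm V | ∀ a ∈ insert x A, π a ∈ C}
    have hpos : 0 < #Aᶜ := card_pos.2 ⟨x, mem_compl.2 hx⟩
    have hadd := card_add_card_compl A
    have hC := card_le_univ C
    -- This is the estimate `(c - a) / (n - a) ≤ c / n` for `c ≤ n`.
    have h1 : Fintype.card V * f' ≤ #C * f := by
      refine le_of_mul_le_mul_left (a := #Aᶜ) ?_ hpos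
      calc #Aᶜ * (Fintype.card V * f') = (Fintype.card V * (#C - #A)) * f := by
            rw [mul_left_comm, h, mul_assoc]
        _ ≤ (#Aᶜ * #C) * f := by
            refine Nat.mul_le_mul_right _ ?_
            rw [Nat.mul_sub]
            have : Fintype.card V * #C = #A * #C + #Aᶜ * #C := by rw [← hadd]; ring
            rw [tsub_le_iff_right, this, add_comm]
            exact Nat.add_le_add_left (by rw [mul_comm]; exact Nat.mul_le_mul_right _ hC) _
        _ = _ := mul_assoc _ _ _
    rw [card_insert_of_notMem hx, pow_succ, pow_succ]
    calc Fintype.card V ^ #A * Fintype.card V * f' = Fintype.card V ^ #A * (Fintype.card V * f') :=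
          mul_assoc _ _ _
      _ ≤ Fintype.card V ^ #A * (#C * f) := Nat.mul_le_mul_left _ h1
      _ = #C * (Fintype.card V ^ #A * f) := by ring
      _ ≤ #C * (#C ^ #A * (Fintype.card V).factorial) := Nat.mul_le_mul_left _ ih
      _ = _ := by ring

open Finset in
-- A random permutation maps `A` off `B` with probability at most `(3/4) ^ (n/4)`. Twenty
-- independent ones do so with probability at most `4 ^ (-n)`, because `3 ^ 5 * 4 ≤ 4 ^ 5`.
lemma card_perm_avoiding_le {V : Type*} [Fintype V] [DecidableEq V] [Nonempty V] (A B : Finset V)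
    (hA : Fintype.card V ≤ 4 * #A) (hB : Fintype.card V ≤ 4 * #B) :
    4 ^ Fintype.card V * #{π : Equiv.Perm V | ∀ a ∈ A, π a ∈ Bᶜ} ^ 20 ≤
      (Fintype.card V).factorial ^ 20 := by
  have h := card_pow_mul_card_perm_le A Bᶜ
  set f := #{π : Equiv.Perm V | ∀ a ∈ A, π a ∈ Bᶜ}
  set n := Fintype.card V with hn
  have hn0 : 0 < n := Fintype.card_pos
  have hc : 4 * #Bᶜ ≤ 3 * n := by
    have := card_add_card_compl B
    omega
  have h1 : 4 ^ #A * f ≤ 3 ^ #A * n.factorial := by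
    refine le_of_mul_le_mul_left (a := n ^ #A) ?_ (by positivity)
    calc n ^ #A * (4 ^ #A * f) = 4 ^ #A * (n ^ #A * f) := by ring
      _ ≤ 4 ^ #A * (#Bᶜ ^ #A * n.factorial) := Nat.mul_le_mul_left _ h
      _ = (4 * #Bᶜ) ^ #A * n.factorial := by rw [mul_pow]; ring
      _ ≤ (3 * n) ^ #A * n.factorial := Nat.mul_le_mul_right _ (Nat.pow_le_pow_left hc _)
      _ = _ := by rw [mul_pow]; ring
  have h2 := Nat.pow_le_pow_left h1 20
  rw [mul_pow, mul_pow, ← pow_mul, ← pow_mul, mul_comm #A 20, pow_mul, pow_mul] at h2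
  refine le_of_mul_le_mul_left (a := (3 ^ 20) ^ #A) ?_ (by positivity)
  calc (3 ^ 20) ^ #A * (4 ^ n * f ^ 20) ≤ (3 ^ 20) ^ #A * (4 ^ (4 * #A) * f ^ 20) := by
        gcongr
        norm_num
    _ = (3 ^ 20 * 4 ^ 4) ^ #A * f ^ 20 := by rw [pow_mul, mul_pow]; ring
    _ ≤ (4 ^ 20) ^ #A * f ^ 20 := by
        refine Nat.mul_le_mul_right _ (Nat.pow_le_pow_left (by norm_num) _)
    _ ≤ _ := h2

open Finset in
-- Union bound over the pairs `(A, B)`: fewer than `4 ^ n` are large enough, since the pair of empty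
-- sets is not, and each is bad with probability at most `4 ^ (-n)`.
theorem exists_expanding_perms (V : Type*) [Fintype V] [DecidableEq V] [Nonempty V] :
    ∃ π : Fin 20 → Equiv.Perm V, ∀ A B : Finset V, Fintype.card V ≤ 4 * #A →
      Fintype.card V ≤ 4 * #B → ∃ j, ∃ v ∈ A, π j v ∈ B := by
  by_contra! hcon
  set n := Fintype.card V with hn
  have hn0 : 0 < n := Fintype.card_pos
  let P : Finset (Finset V × Finset V) := {p | n ≤ 4 * #p.1 ∧ n ≤ 4 * #p.2}
  let bad : Finset V × Finset V → Finset (Fin 20 → Equiv.Perm V) := fun p ↦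
    Fintype.piFinset fun _ ↦ {π : Equiv.Perm V | ∀ a ∈ p.1, π a ∈ p.2ᶜ}
  have hcover : (univ : Finset (Fin 20 → Equiv.Perm V)) ⊆ P.biUnion bad := by
    intro π _
    obtain ⟨A, B, hA, hB, h⟩ := hcon π
    refine mem_biUnion.2 ⟨(A, B), mem_filter.2 ⟨mem_univ _, hA, hB⟩, ?_⟩
    rw [Fintype.mem_piFinset]
    exact fun j ↦ mem_filter.2 ⟨mem_univ _, fun a ha ↦ mem_compl.2 (h j a ha)⟩
  have h1 := (card_le_card hcover).trans card_biUnion_le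
  have h2 : #(univ : Finset (Fin 20 → Equiv.Perm V)) = n.factorial ^ 20 := by
    simp [Fintype.card_perm, hn]
  have h3 : ∀ p ∈ P, 4 ^ n * #(bad p) ≤ n.factorial ^ 20 := by
    intro p hp
    obtain ⟨hA, hB⟩ := (mem_filter.1 hp).2
    rw [Fintype.card_piFinset_const]
    exact card_perm_avoiding_le p.1 p.2 hA hB
  have h4 : #P < 4 ^ n := by
    have : P ⊂ univ := by
      refine (ssubset_univ_iff).2 fun h ↦ ?_
      have : ((∅, ∅) : Finset V × Finset V) ∈ P := h ▸ mem_univ _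
      have := (mem_filter.1 this).2.1
      rw [card_empty] at this
      omega
    refine (card_lt_card this).trans_eq ?_
    rw [card_univ, Fintype.card_prod, Fintype.card_finset, ← hn, ← mul_pow]
    norm_num
  have h5 : 4 ^ n * n.factorial ^ 20 ≤ #P * n.factorial ^ 20 := by
    calc 4 ^ n * n.factorial ^ 20 ≤ 4 ^ n * ∑ p ∈ P, #(bad p) := by
          rw [← h2]; exact Nat.mul_le_mul_left _ h1
      _ = ∑ p ∈ P, 4 ^ n * #(bad p) := mul_sum _ _ _
      _ ≤ ∑ p ∈ P, n.factorial ^ 20 := sum_le_sum h3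
      _ = _ := by rw [sum_const, smul_eq_mul]
  exact absurd (Nat.le_of_mul_le_mul_right h5 (by positivity)) (not_le.2 h4)

/-- The relation between blocks of `w` consecutive numbers given by the pairs `2 * i`,
`2 * σ i + 1` with `i < h`. -/
def BlockLink (σ : Equiv.Perm ℕ) (h w v v' : ℕ) : Prop :=
  ∃ i < h, 2 * i / w = v ∧ (2 * σ i + 1) / w = v'

/-- The number `j + 20 * v` encodes port `j` of block `v`, and `σ` applies the `j`-th permutation to
`v` while keeping `j`. Both `2 * i` and `2 * i + 1` then lie in block `i / 20` of width 40. -/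
theorem exists_expanding_blockLink {m : ℕ} (hm : 0 < m) :
    ∃ σ : Equiv.Perm ℕ, (∀ i, σ i < 20 * m ↔ i < 20 * m) ∧
      Expanding m (BlockLink σ (20 * m) 40) := by
  have : Nonempty (Fin m) := ⟨⟨0, hm⟩⟩
  obtain ⟨π, hπ⟩ := exists_expanding_perms (Fin m)
  let p : Equiv.Perm (Fin m × Fin 20) :=
    { toFun := fun x ↦ (π x.2 x.1, x.2)
      invFun := fun x ↦ ((π x.2).symm x.1, x.2)
      left_inv := fun x ↦ by simp
      right_inv := fun x ↦ by simp }
  let e : Fin m × Fin 20 ≃ {i : ℕ // i < 20 * m} := 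
    (finProdFinEquiv.trans (finCongr (mul_comm m 20))).trans Fin.equivSubtype
  have he : ∀ x, (e x : ℕ) = x.2 + 20 * x.1 := fun x ↦ rfl
  refine ⟨p.extendDomain e, fun i ↦ ?_, ?_⟩
  · by_cases hi : i < 20 * m
    · rw [Equiv.Perm.extendDomain_apply_subtype p e hi]
      exact ⟨fun _ ↦ hi, fun _ ↦ (e _).2⟩
    · rw [Equiv.Perm.extendDomain_apply_not_subtype p e hi]
  · intro A hA B hB _ hAm hBm
    have hcard : ∀ S ⊆ Finset.range m, (Finset.univ.filter fun x : Fin m ↦ (x : ℕ) ∈ S).card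
        = S.card := by
      intro S hS
      refine Finset.card_bij (fun x _ ↦ (x : ℕ)) (fun x hx ↦ (Finset.mem_filter.1 hx).2)
        (fun x _ y _ h ↦ Fin.ext h) fun b hb ↦ ⟨⟨b, Finset.mem_range.1 (hS hb)⟩, ?_, rfl⟩
      exact Finset.mem_filter.2 ⟨Finset.mem_univ _, hb⟩
    obtain ⟨j, v, hv, hw⟩ := hπ (Finset.univ.filter fun x : Fin m ↦ (x : ℕ) ∈ A)
      (Finset.univ.filter fun x : Fin m ↦ (x : ℕ) ∈ B)
      (by rwa [hcard A hA, Fintype.card_fin]) (by rwa [hcard B hB, Fintype.card_fin])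
    refine ⟨v, (Finset.mem_filter.1 hv).2, π j v, (Finset.mem_filter.1 hw).2, e (v, j), ?_, ?_, ?_⟩
    · exact (e (v, j)).2
    · rw [he]
      have := j.2
      dsimp only
      omega
    · rw [Equiv.Perm.extendDomain_apply_image, he]
      have := j.2
      dsimp only [p, Equiv.coe_fn_mk]
      omega

/-! ### Grids with bundles of edges through handles -/

/-- Parameters for a grid with `k` rows whose columns come in `2 * h + 1` groups of `k`. The bottom
ends of the groups `2 * i` and `2 * σ i + 1` with `i < h` are joined by bundles of `k` edges. -/
structure GridParams where
  h : ℕ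
  k : ℕ
  σ : Equiv.Perm ℕ
  two_le : 2 ≤ k
  even : Even k
  lt_iff : ∀ i, σ i < h ↔ i < h

/-- Labels for the edges of a grid: horizontal and vertical edges, edges that join the ends of two
consecutive rows or columns, and edges that pass through handles. -/
inductive GridEdge
  | hor (x y : ℕ)
  | ver (x y : ℕ)
  | top (j : ℕ)
  | bot (j : ℕ)
  | left (j : ℕ)
  | right (j : ℕ)
  | handle (i a : ℕ)

namespace GridParams

variable (P : GridParams)

/-- The number of columns that end in a handle. -/
def handleWidth : ℕ := 2 * P.h * P.k

/-- The number of columns. -/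
def width : ℕ := P.handleWidth + P.k

/-- The column in which the first half of the edge `handle i a` is drawn. -/
def colFst (i a : ℕ) : ℕ := 2 * i * P.k + a

/-- The column in which the second half of the edge `handle i a` is drawn. -/
def colSnd (i a : ℕ) : ℕ := (2 * P.σ i + 1) * P.k + (P.k - 1 - a)

/-- The labels that are edges of the grid. -/
def Valid : GridEdge → Prop
  | .hor x y => x + 1 < P.width ∧ y < P.k
  | .ver x y => x < P.width ∧ y + 1 < P.k
  | .top j => 2 * j + 1 < P.width
  | .bot j => P.handleWidth ≤ 2 * j ∧ 2 * j + 1 < P.width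
  | .left j => 2 * j + 1 < P.k
  | .right j => 2 * j + 1 < P.k
  | .handle i a => i < P.h ∧ a < P.k

/-- The first end of an edge. -/
def fst : GridEdge → ℕ × ℕ
  | .hor x y => (x, y)
  | .ver x y => (x, y)
  | .top j => (2 * j, P.k - 1)
  | .bot j => (2 * j, 0)
  | .left j => (0, 2 * j)
  | .right j => (P.width - 1, 2 * j)
  | .handle i a => (P.colFst i a, 0)

/-- The second end of an edge. -/
def snd : GridEdge → ℕ × ℕ
  | .hor x y => (x + 1, y)
  | .ver x y => (x, y + 1)
  | .top j => (2 * j + 1, P.k - 1)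
  | .bot j => (2 * j + 1, 0)
  | .left j => (0, 2 * j + 1)
  | .right j => (P.width - 1, 2 * j + 1)
  | .handle i a => (P.colSnd i a, 0)

lemma mul_add_lt_handleWidth {p r : ℕ} (hp : p < 2 * P.h) (hr : r < P.k) :
    p * P.k + r < P.handleWidth := by
  have : (p + 1) * P.k ≤ 2 * P.h * P.k := Nat.mul_le_mul_right _ hp
  rw [handleWidth]
  linarith

lemma colFst_lt {i a : ℕ} (hi : i < P.h) (ha : a < P.k) : P.colFst i a < P.handleWidth :=
  P.mul_add_lt_handleWidth (by omega) ha

lemma colSnd_lt {i a : ℕ} (hi : i < P.h) (ha : a < P.k) : P.colSnd i a < P.handleWidth :=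
  P.mul_add_lt_handleWidth (by have := (P.lt_iff i).2 hi; omega) (by omega)

lemma div_mod_of_eq {k x p r : ℕ} (hr : r < k) (hx : x = p * k + r) : x / k = p ∧ x % k = r := by
  subst hx
  rw [mul_comm, Nat.mul_add_div (by omega), Nat.div_eq_of_lt hr, Nat.mul_add_mod,
    Nat.mod_eq_of_lt hr]
  simp

lemma eq_mul_add_iff {k x p r : ℕ} (hr : r < k) : x = p * k + r ↔ x / k = p ∧ x % k = r := by
  refine ⟨div_mod_of_eq hr, ?_⟩
  rintro ⟨rfl, rfl⟩
  exact (Nat.div_add_mod' x k).symm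

lemma colFst_ne_colSnd {i i' a a' : ℕ} (ha : a < P.k) (ha' : a' < P.k) :
    P.colFst i a ≠ P.colSnd i' a' := by
  intro h
  have h1 := div_mod_of_eq ha (rfl : P.colFst i a = _)
  rw [h] at h1
  have h2 := div_mod_of_eq (r := P.k - 1 - a') (by omega) (rfl : P.colSnd i' a' = _)
  omega

lemma colFst_inj {i i' a a' : ℕ} (ha : a < P.k) (ha' : a' < P.k)
    (h : P.colFst i a = P.colFst i' a') : i = i' ∧ a = a' := by
  have h1 := div_mod_of_eq ha (rfl : P.colFst i a = _)
  rw [h] at h1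
  have h2 := div_mod_of_eq ha' (rfl : P.colFst i' a' = _)
  omega

lemma colSnd_inj {i i' a a' : ℕ} (ha : a < P.k) (ha' : a' < P.k)
    (h : P.colSnd i a = P.colSnd i' a') : i = i' ∧ a = a' := by
  have h1 := div_mod_of_eq (r := P.k - 1 - a) (by omega) (rfl : P.colSnd i a = _)
  rw [h] at h1
  have h2 := div_mod_of_eq (r := P.k - 1 - a') (by omega) (rfl : P.colSnd i' a' = _)
  exact ⟨P.σ.injective (by omega), by omega⟩

lemma fst_mem {e : GridEdge} (he : P.Valid e) : (P.fst e).1 < P.width ∧ (P.fst e).2 < P.k := by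
  have := P.two_le
  cases e <;> simp only [Valid, fst, width] at he ⊢
  case handle i a => have := P.colFst_lt he.1 he.2; omega
  all_goals omega

lemma snd_mem {e : GridEdge} (he : P.Valid e) : (P.snd e).1 < P.width ∧ (P.snd e).2 < P.k := by
  have := P.two_le
  cases e <;> simp only [Valid, snd, width] at he ⊢
  case handle i a => have := P.colSnd_lt he.1 he.2; omega
  all_goals omega

lemma fst_ne_snd {e : GridEdge} (he : P.Valid e) : P.fst e ≠ P.snd e := by
  cases e <;> simp only [fst, snd, ne_eq, Prod.mk.injEq]
  case handle i a => exact fun h ↦ P.colFst_ne_colSnd he.2 he.2 h.1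
  all_goals omega

/-- The grid graph: consecutive rows and columns are paired and their ends joined, except for the
bottom ends of the first `2 * h` groups of columns, which are joined in pairs of groups. -/
def graph : Graph (ℕ × ℕ) GridEdge where
  vertexSet := {p | p.1 < P.width ∧ p.2 < P.k}
  edgeSet := {e | P.Valid e}
  IsLink e u v := P.Valid e ∧ (u = P.fst e ∧ v = P.snd e ∨ u = P.snd e ∧ v = P.fst e)
  isLink_symm _ _ := ⟨fun _ _ h ↦ ⟨h.1, h.2.symm.imp And.symm And.symm⟩⟩
  eq_or_eq_of_isLink_of_isLink := by
    rintro e x y v w ⟨-, ⟨rfl, rfl⟩ | ⟨rfl, rfl⟩⟩ ⟨-, ⟨rfl, rfl⟩ | ⟨rfl, rfl⟩⟩ <;> simp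
  edge_mem_iff_exists_isLink e :=
    ⟨fun h ↦ ⟨P.fst e, P.snd e, h, .inl ⟨rfl, rfl⟩⟩, fun ⟨_, _, h⟩ ↦ h.1⟩
  left_mem_of_isLink := by
    rintro e x y ⟨he, ⟨rfl, rfl⟩ | ⟨rfl, rfl⟩⟩
    · exact P.fst_mem he
    · exact P.snd_mem he

lemma isLink_fst_snd {e : GridEdge} (he : P.Valid e) : P.graph.IsLink e (P.fst e) (P.snd e) :=
  ⟨he, .inl ⟨rfl, rfl⟩⟩

lemma vertexSet_eq : P.graph.vertexSet =
    (Finset.range P.width ×ˢ Finset.range P.k : Finset (ℕ × ℕ)) := by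
  ext ⟨x, y⟩
  simp [graph]

lemma finite_vertexSet : P.graph.vertexSet.Finite := by
  rw [vertexSet_eq]
  exact Finset.finite_toSet _

lemma ncard_vertexSet : P.graph.vertexSet.ncard = (2 * P.h + 1) * P.k ^ 2 := by
  rw [vertexSet_eq, Set.ncard_coe_finset, Finset.card_product, Finset.card_range, Finset.card_range,
    width, handleWidth]
  ring

/-! ### Regularity -/

/-- The edge that leaves a vertex in the bottom row downwards. -/
def bottomEdge (x : ℕ) : GridEdge :=
  if x < P.handleWidth then
    if x / P.k % 2 = 0 then .handle (x / P.k / 2) (x % P.k)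
    else .handle (P.σ.symm (x / P.k / 2)) (P.k - 1 - x % P.k)
  else .bot (x / 2)

/-- The edge that leaves a vertex to the right. -/
def rightEdge (x y : ℕ) : GridEdge := if x + 1 < P.width then .hor x y else .right (y / 2)

/-- The edge that leaves a vertex to the left. -/
def leftEdge (x y : ℕ) : GridEdge := if 0 < x then .hor (x - 1) y else .left (y / 2)

/-- The edge that leaves a vertex upwards. -/
def upEdge (x y : ℕ) : GridEdge := if y + 1 < P.k then .ver x y else .top (x / 2)

/-- The edge that leaves a vertex downwards. -/
def downEdge (x y : ℕ) : GridEdge := if 0 < y then .ver x (y - 1) else P.bottomEdge x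

lemma even_handleWidth : P.handleWidth % 2 = 0 := by
  rw [handleWidth, mul_assoc, Nat.mul_mod_right]

lemma handle_eq_bottomEdge_iff {x i a : ℕ} :
    GridEdge.handle i a = P.bottomEdge x ↔
      (i < P.h ∧ a < P.k) ∧ (x = P.colFst i a ∨ x = P.colSnd i a) := by
  have h2 := P.two_le
  have hmod : x % P.k < P.k := Nat.mod_lt _ (by omega)
  have hdiv : x < P.handleWidth ↔ x / P.k < 2 * P.h := by
    rw [handleWidth, Nat.div_lt_iff_lt_mul (by omega)]
  constructor
  · rw [bottomEdge]
    split_ifs with h1 h3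
    · intro h
      obtain ⟨rfl, rfl⟩ := GridEdge.handle.inj h
      have : x / P.k / 2 < P.h := by have := hdiv.1 h1; omega
      refine ⟨⟨this, hmod⟩, .inl ?_⟩
      rw [colFst, eq_mul_add_iff hmod]
      omega
    · intro h
      obtain ⟨rfl, rfl⟩ := GridEdge.handle.inj h
      have : x / P.k / 2 < P.h := by have := hdiv.1 h1; omega
      refine ⟨⟨by rw [← P.lt_iff]; simpa using this, by omega⟩, .inr ?_⟩
      rw [colSnd, eq_mul_add_iff (by omega), Equiv.apply_symm_apply]
      omega
    · intro h
      cases h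
  · rintro ⟨⟨hi, ha⟩, h | h⟩
    · have h3 := (eq_mul_add_iff ha).1 h
      rw [bottomEdge, if_pos (h ▸ P.colFst_lt hi ha), if_pos (by omega), h3.1, h3.2]
      congr 1
      omega
    · have h3 := (eq_mul_add_iff (by omega)).1 h
      rw [bottomEdge, if_pos (h ▸ P.colSnd_lt hi ha), if_neg (by omega), h3.1, h3.2]
      congr 1
      · rw [Equiv.eq_symm_apply]
        omega
      · omega

lemma bot_eq_bottomEdge_iff {x j : ℕ} :
    GridEdge.bot j = P.bottomEdge x ↔ P.handleWidth ≤ 2 * j ∧ (x = 2 * j ∨ x = 2 * j + 1) := by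
  have := P.even_handleWidth
  rw [bottomEdge]
  split_ifs <;> simp <;> omega

lemma bottomEdge_cases (x : ℕ) :
    (∃ i a, P.bottomEdge x = .handle i a) ∨ ∃ j, P.bottomEdge x = .bot j := by
  rw [bottomEdge]
  split_ifs <;> simp

/-- As `k`, the width and the handle width are even, pairing `2 * j` with `2 * j + 1` leaves no
border end unmatched, and each of the four directions at a vertex carries one edge. -/
lemma inc_iff {x y : ℕ} (hx : x < P.width) (hy : y < P.k) (e : GridEdge) :
    (P.Valid e ∧ ((x, y) = P.fst e ∨ (x, y) = P.snd e)) ↔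
      e = P.rightEdge x y ∨ e = leftEdge x y ∨ e = P.upEdge x y ∨ e = P.downEdge x y := by
  have h2 := P.two_le
  have heven := Nat.even_iff.1 P.even
  have hw : P.width % 2 = 0 := by
    have := P.even_handleWidth
    rw [width]
    omega
  have hbot := P.bottomEdge_cases x
  cases e
  case handle i a =>
    have h := P.handle_eq_bottomEdge_iff (x := x) (i := i) (a := a)
    simp only [rightEdge, leftEdge, upEdge, downEdge, Valid, fst, snd, Prod.mk.injEq]
    split_ifs <;> simp <;> grind
  case bot j =>
    have h := P.bot_eq_bottomEdge_iff (x := x) (j := j)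
    simp only [rightEdge, leftEdge, upEdge, downEdge, Valid, fst, snd, Prod.mk.injEq]
    split_ifs <;> simp <;> grind
  all_goals
    simp only [rightEdge, leftEdge, upEdge, downEdge, Valid, fst, snd, Prod.mk.injEq]
    rcases hbot with ⟨i, a, h⟩ | ⟨j, h⟩ <;> rw [h] <;> split_ifs <;> simp <;> omega

lemma setOf_isNonloopAt {x y : ℕ} (hx : x < P.width) (hy : y < P.k) :
    {e | P.graph.IsNonloopAt e (x, y)} =
      {P.rightEdge x y, leftEdge x y, P.upEdge x y, P.downEdge x y} := by
  ext e
  simp only [Set.mem_ofPred_eq, Set.mem_insert_iff, Set.mem_singleton_iff]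
  rw [← P.inc_iff hx hy]
  constructor
  · rintro ⟨v, -, he, h⟩
    exact ⟨he, h.imp And.left And.left⟩
  · rintro ⟨he, h | h⟩
    · exact ⟨P.snd e, by rw [h]; exact (P.fst_ne_snd he).symm, he, .inl ⟨h, rfl⟩⟩
    · exact ⟨P.fst e, by rw [h]; exact P.fst_ne_snd he, he, .inr ⟨h, rfl⟩⟩

theorem isRegularOfDegree_graph : IsRegularOfDegree P.graph 4 := by
  rintro ⟨x, y⟩ ⟨hx, hy⟩
  have hloop : {e | P.graph.IsLoopAt e (x, y)} = ∅ := by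
    refine Set.eq_empty_of_forall_notMem fun e he ↦ ?_
    obtain ⟨he, h | h⟩ := he
    · exact P.fst_ne_snd he (h.1.symm.trans h.2)
    · exact P.fst_ne_snd he (h.2.symm.trans h.1)
  dsimp only at hx hy
  have hbot := P.bottomEdge_cases x
  rw [degree, hloop, P.setOf_isNonloopAt hx hy, Set.encard_insert_of_notMem,
    Set.encard_insert_of_notMem, Set.encard_insert_of_notMem, Set.encard_singleton,
    Set.encard_empty]
  · norm_num
  all_goals
    simp only [rightEdge, leftEdge, upEdge, downEdge, Set.mem_insert_iff, Set.mem_singleton_iff]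
    rcases hbot with ⟨i, a, h⟩ | ⟨j, h⟩ <;> rw [h] <;> split_ifs <;> simp <;> omega

lemma finite_edgeSet : P.graph.edgeSet.Finite := by
  refine (P.finite_vertexSet.biUnion fun v hv ↦
    (show {e | P.graph.IsNonloopAt e v}.Finite from ?_)).subset fun e he ↦
      Set.mem_iUnion₂.2 ⟨P.fst e, P.fst_mem he, P.snd e, (P.fst_ne_snd he).symm,
        P.isLink_fst_snd he⟩
  rw [P.setOf_isNonloopAt hv.1 hv.2]
  exact Set.toFinite _

/-! ### Treewidth of the grid graph -/

lemma adj_row {x y : ℕ} (hx : x + 1 < P.width) (hy : y < P.k) :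
    P.graph.Adj (x, y) (x + 1, y) :=
  ⟨.hor x y, P.isLink_fst_snd (e := .hor x y) ⟨hx, hy⟩⟩

lemma adj_col {x y : ℕ} (hx : x < P.width) (hy : y + 1 < P.k) :
    P.graph.Adj (x, y) (x, y + 1) :=
  ⟨.ver x y, P.isLink_fst_snd (e := .ver x y) ⟨hx, hy⟩⟩

lemma reflTransGen_of_adj_succ {α β : Type*} {G : Graph α β} {S : Set α} {f : ℕ → α} {n n' : ℕ}
    (hn : n ≤ n') (hS : ∀ i, n ≤ i → i ≤ n' → f i ∈ S)
    (hadj : ∀ i, n ≤ i → i < n' → G.Adj (f i) (f (i + 1))) :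
    ReflTransGen (fun a b ↦ b ∈ S ∧ G.Adj a b) (f n) (f n') ∧
      ReflTransGen (fun a b ↦ b ∈ S ∧ G.Adj a b) (f n') (f n) := by
  induction n', hn using Nat.le_induction with
  | base => exact ⟨.refl, .refl⟩
  | succ j hj ih =>
    obtain ⟨h1, h2⟩ := ih (fun i hi hi' ↦ hS i hi (hi'.trans j.le_succ))
      (fun i hi hi' ↦ hadj i hi (hi'.trans j.lt_succ_self))
    have h := hadj j hj j.lt_succ_self
    exact ⟨h1.tail ⟨hS _ (hj.trans j.le_succ) le_rfl, h⟩,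
      h2.head ⟨hS _ hj j.le_succ, h.symm⟩⟩

lemma reflTransGen_row {S : Set (ℕ × ℕ)} (hS : S ⊆ P.graph.vertexSet) {x x' y : ℕ}
    (h : ∀ z, min x x' ≤ z → z ≤ max x x' → (z, y) ∈ S) :
    ReflTransGen (fun a b ↦ b ∈ S ∧ P.graph.Adj a b) (x, y) (x', y) := by
  have hadj : ∀ i, min x x' ≤ i → i < max x x' → P.graph.Adj (i, y) (i + 1, y) := fun i hi hi' ↦
    P.adj_row (hS (h (i + 1) (by omega) hi')).1 (hS (h i hi hi'.le)).2
  rcases le_total x x' with hx | hx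
  · rw [min_eq_left hx, max_eq_right hx] at h hadj
    exact (reflTransGen_of_adj_succ (f := fun z ↦ (z, y)) hx h hadj).1
  · rw [min_eq_right hx, max_eq_left hx] at h hadj
    exact (reflTransGen_of_adj_succ (f := fun z ↦ (z, y)) hx h hadj).2

lemma reflTransGen_col {S : Set (ℕ × ℕ)} (hS : S ⊆ P.graph.vertexSet) {x y y' : ℕ}
    (h : ∀ z < P.k, (x, z) ∈ S) (hy : y < P.k) (hy' : y' < P.k) :
    ReflTransGen (fun a b ↦ b ∈ S ∧ P.graph.Adj a b) (x, y) (x, y') := by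
  rcases le_total y y' with hyy | hyy
  · exact (reflTransGen_of_adj_succ (f := fun z ↦ (x, z)) hyy (fun i _ hi ↦ h i (by omega))
      fun i _ hi ↦ P.adj_col (hS (h y hy)).1 (by omega)).1
  · exact (reflTransGen_of_adj_succ (f := fun z ↦ (x, z)) hyy (fun i _ hi ↦ h i (by omega))
      fun i _ hi ↦ P.adj_col (hS (h y hy)).1 (by omega)).2

/-- The position of a column in its group, counted from the left in groups of even index and from
the right in groups of odd index. -/
def label (x : ℕ) : ℕ := if x / P.k % 2 = 0 then x % P.k else P.k - 1 - x % P.k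

/-- The union of row `a` and all the columns of label `a` in the `v`-th block of `w` consecutive
groups of columns. -/
def cross (w v a : ℕ) : Set (ℕ × ℕ) :=
  {p | (p.1 < P.width ∧ p.2 < P.k) ∧ p.1 / P.k / w = v ∧ (p.2 = a ∨ P.label p.1 = a)}

/-- The first group of the block, of index `w * v`, already contains every label. -/
lemma exists_label_eq {w v b : ℕ} (hw : 0 < w) (hv : w * (v + 1) ≤ 2 * P.h + 1) (hb : b < P.k) :
    ∃ x < P.width, x / P.k / w = v ∧ P.label x = b := by
  have hwidth : ∀ r < P.k, w * v * P.k + r < P.width := fun r hr ↦ by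
    have h1 : w * v + 1 ≤ 2 * P.h + 1 := by rw [mul_add] at hv; omega
    have h2 := Nat.mul_le_mul_right P.k h1
    rw [add_mul, add_mul, one_mul] at h2
    rw [width, handleWidth]
    omega
  by_cases hpar : w * v % 2 = 0
  · obtain ⟨h1, h2⟩ := div_mod_of_eq hb (rfl : w * v * P.k + b = _)
    refine ⟨w * v * P.k + b, hwidth b hb, ?_, ?_⟩
    · rw [h1, Nat.mul_div_cancel_left _ hw]
    · rw [label, h1, h2, if_pos hpar]
  · obtain ⟨h1, h2⟩ := div_mod_of_eq (r := P.k - 1 - b) (by omega)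
      (rfl : w * v * P.k + (P.k - 1 - b) = _)
    refine ⟨w * v * P.k + (P.k - 1 - b), hwidth _ (by omega), ?_, ?_⟩
    · rw [h1, Nat.mul_div_cancel_left _ hw]
    · rw [label, h1, h2, if_neg hpar]
      omega

lemma cross_subset (w v a : ℕ) : P.cross w v a ⊆ P.graph.vertexSet := fun _ h ↦ h.1

lemma connectedOn_cross (w v : ℕ) {a : ℕ} (ha : a < P.k) :
    ConnectedOn P.graph (P.cross w v a) := by
  have hsub := P.cross_subset w v a
  have hcol : ∀ x y, (x, y) ∈ P.cross w v a →
      ReflTransGen (fun p q ↦ q ∈ P.cross w v a ∧ P.graph.Adj p q) (x, y) (x, a) ∧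
      ReflTransGen (fun p q ↦ q ∈ P.cross w v a ∧ P.graph.Adj p q) (x, a) (x, y) := by
    rintro x y ⟨⟨hx, hy⟩, hv, rfl | hl⟩
    · exact ⟨.refl, .refl⟩
    · have h : ∀ z < P.k, (x, z) ∈ P.cross w v a := fun z hz ↦ ⟨⟨hx, hz⟩, hv, .inr hl⟩
      exact ⟨P.reflTransGen_col hsub h hy ha, P.reflTransGen_col hsub h ha hy⟩
  rintro ⟨x, y⟩ hxy ⟨x', y'⟩ hxy'
  refine (hcol x y hxy).1.trans (.trans ?_ (hcol x' y' hxy').2)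
  refine P.reflTransGen_row hsub fun z hz hz' ↦ ?_
  obtain ⟨⟨hx, -⟩, hv, -⟩ := hxy
  obtain ⟨⟨hx', -⟩, hv', -⟩ := hxy'
  dsimp only at hx hx' hv hv'
  refine ⟨⟨by omega, ha⟩, ?_, .inl rfl⟩
  -- Blocks are intervals of columns, so a row segment with both ends in a block stays in it.
  have hmono : ∀ s t, s ≤ t → s / P.k / w ≤ t / P.k / w := fun s t h ↦
    Nat.div_le_div_right (Nat.div_le_div_right h)
  have h1 := hmono _ _ hz
  have h2 := hmono _ _ hz'
  dsimp only
  rcases le_total x x' with h | h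
  · rw [min_eq_left h] at h1
    rw [max_eq_right h] at h2
    omega
  · rw [min_eq_right h] at h1
    rw [max_eq_left h] at h2
    omega

/-- Handle edges reverse the order of columns, and labels in odd groups are counted from the right,
so both ends of `handle i a` have label `a`. -/
lemma touching_cross {w v v' : ℕ} (h : BlockLink P.σ P.h w v v') {a : ℕ} (ha : a < P.k) :
    Touching P.graph (P.cross w v a) (P.cross w v' a) := by
  obtain ⟨i, hi, rfl, rfl⟩ := h
  have he : P.Valid (.handle i a) := ⟨hi, ha⟩
  obtain ⟨h1, h2⟩ := div_mod_of_eq ha (rfl : P.colFst i a = _)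
  obtain ⟨h3, h4⟩ := div_mod_of_eq (r := P.k - 1 - a) (by omega) (rfl : P.colSnd i a = _)
  refine ⟨_, ⟨P.fst_mem he, ?_, .inr ?_⟩, _, ⟨P.snd_mem he, ?_, .inr ?_⟩,
    .inr ⟨_, P.isLink_fst_snd he⟩⟩
  · rw [fst, h1]
  · rw [fst, label, h1, h2, if_pos (by omega)]
  · rw [snd, h3]
  · rw [snd, label, h3, h4, if_neg (by omega)]
    omega

theorem le_treewidth_graph {m w s : ℕ} (hm : 0 < m) (hw : 0 < w) (hwm : w * m ≤ 2 * P.h + 1)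
    (hexp : Expanding m (BlockLink P.σ P.h w)) (hs : 64 * s ≤ m * P.k) :
    s ≤ treewidth P.graph := by
  refine le_treewidth_of_expanding P.finite_vertexSet hm (by have := P.two_le; omega)
    (L := P.cross w) (f₁ := fun p ↦ (p.1 / P.k / w, p.2))
    (f₂ := fun p ↦ (p.1 / P.k / w, P.label p.1)) (fun v _ a _ ↦ P.cross_subset w v a)
    (fun v _ a ha ↦ P.connectedOn_cross w v ha) ?_ ?_
    (fun v _ v' _ h a ha ↦ P.touching_cross h ha) hexp hs
  · intro v hv a ha b hb
    obtain ⟨x, hx, hxv, hxb⟩ :=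
      P.exists_label_eq hw ((Nat.mul_le_mul_left w hv).trans hwm) hb
    exact ⟨(x, a), ⟨⟨hx, ha⟩, hxv, .inl rfl⟩, ⟨hx, ha⟩, hxv, .inr hxb⟩
  · rintro v a p ⟨-, rfl, rfl | rfl⟩
    · exact .inl rfl
    · exact .inr rfl

/-- A 4-cycle in a corner splits into three connected, pairwise touching pieces, and no two vertices
hit all three. -/
theorem two_le_treewidth_graph : 2 ≤ treewidth P.graph := by
  classical
  have hk := P.two_le
  have hw : 2 ≤ P.width := hk.trans (Nat.le_add_left _ _)
  have hsingle : ∀ p : ℕ × ℕ, ConnectedOn P.graph {p} := by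
    rintro p _ rfl _ rfl
    exact .refl
  have h01 : P.graph.Adj (0, 0) (0, 1) := P.adj_col (by omega) (by omega)
  have h02 : P.graph.Adj (0, 0) (1, 0) := P.adj_row (by omega) (by omega)
  have h13 : P.graph.Adj (0, 1) (1, 1) := P.adj_row (by omega) (by omega)
  have h23 : P.graph.Adj (1, 0) (1, 1) := P.adj_col (by omega) (by omega)
  let B : Fin 3 → Set (ℕ × ℕ) := ![{(0, 0)}, {(1, 0)}, {(0, 1), (1, 1)}]
  let C : Set (ℕ × ℕ) → Set (ℕ × ℕ) := fun X ↦
    if (0, 0) ∈ X then if (1, 0) ∈ X then B 2 else B 1 else B 0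
  have hC : ∀ X, ∃ i, C X = B i := by
    intro X
    simp only [C]
    split_ifs <;> exact ⟨_, rfl⟩
  have hB : ∀ i, B i ⊆ P.graph.vertexSet ∧ (B i).Nonempty ∧ ConnectedOn P.graph (B i) := by
    intro i
    fin_cases i
    · exact ⟨Set.singleton_subset_iff.2 h01.left_mem, Set.singleton_nonempty _, hsingle _⟩
    · exact ⟨Set.singleton_subset_iff.2 h23.left_mem, Set.singleton_nonempty _, hsingle _⟩
    · refine ⟨Set.pair_subset h13.left_mem h13.right_mem, Set.insert_nonempty _ _, ?_⟩
      rintro _ (rfl | rfl) _ (rfl | rfl)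
      · exact .refl
      · exact .single ⟨.inr rfl, h13⟩
      · exact .single ⟨.inl rfl, h13.symm⟩
      · exact .refl
  have htouch : ∀ i j, Touching P.graph (B i) (B j) := by
    intro i j
    fin_cases i <;> fin_cases j
    · exact ⟨_, rfl, _, rfl, .inl rfl⟩
    · exact ⟨_, rfl, _, rfl, .inr h02⟩
    · exact ⟨_, rfl, _, .inl rfl, .inr h01⟩
    · exact ⟨_, rfl, _, rfl, .inr h02.symm⟩
    · exact ⟨_, rfl, _, rfl, .inl rfl⟩
    · exact ⟨_, rfl, _, .inr rfl, .inr h23⟩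
    · exact ⟨_, .inl rfl, _, rfl, .inr h01.symm⟩
    · exact ⟨_, .inr rfl, _, rfl, .inr h23.symm⟩
    · exact ⟨_, .inl rfl, _, .inl rfl, .inl rfl⟩
  refine le_treewidth P.finite_vertexSet 2 C (fun X _ hX ↦ ?_) fun X _ Y _ _ _ ↦ ?_
  · obtain ⟨i, hi⟩ := hC X
    refine ⟨hi ▸ (hB i).1, hi ▸ (hB i).2.1, hi ▸ (hB i).2.2, ?_⟩
    simp only [C]
    split_ifs with h0 h1
    · have hsub : ({(0, 0), (1, 0)} : Set (ℕ × ℕ)) ⊆ X := Set.pair_subset h0 h1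
      have hcard : ({(0, 0), (1, 0)} : Set (ℕ × ℕ)).encard = 2 := Set.encard_pair (by simp)
      have hXeq := (Set.finite_of_encard_le_coe hX).eq_of_subset_of_encard_le' hsub
        (hX.trans_eq hcard.symm)
      rw [← hXeq]
      simp [B]
    · exact Set.disjoint_singleton_right.2 h1
    · exact Set.disjoint_singleton_right.2 h0
  · obtain ⟨i, hi⟩ := hC X
    obtain ⟨j, hj⟩ := hC Y
    rw [hi, hj]
    exact htouch i j

end GridParams

/-! ### Points of a sphere with handles -/

namespace Handles

variable {g : ℕ} (h : Handles g)

lemma coe_mem_holed {z : ℂ} :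
    (z : OnePoint ℂ) ∈ h.holed ↔ ∀ k, h.radius k ≤ ‖z - h.center k‖ := by
  simp [holed, dist_eq_norm]

lemma eq_of_norm_sub_eq {k l : Fin g × Bool} {z : ℂ} (hk : ‖z - h.center k‖ = h.radius k)
    (hl : ‖z - h.center l‖ = h.radius l) : k = l := by
  by_contra hkl
  refine Set.disjoint_left.1 (h.disjoint k l hkl) (show z ∈ _ from ?_) ?_ <;>
    simp [dist_eq_norm, hk, hl]

lemma Glued.left_unique {p p' q : h.holed} (hp : h.Glued p q) (hp' : h.Glued p' q) : p = p' := by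
  obtain ⟨i, z, w, h1, h2, h3, h4, h5⟩ := hp
  obtain ⟨i', z', w', h1', h2', h3', h4', h5'⟩ := hp'
  obtain rfl : w = w' := OnePoint.coe_injective (h2.symm.trans h2')
  obtain rfl : i = i' := congrArg Prod.fst (h.eq_of_norm_sub_eq h4 h4')
  have hw : w - h.center (i, true) ≠ 0 := by
    rw [← norm_pos_iff, h4]
    exact h.radius_pos _
  have := mul_right_cancel₀ hw (h5.trans h5'.symm)
  exact Subtype.ext (by rw [h1, h1', sub_left_injective this])

/-- First and second circles are disjoint, so gluing steps never chain and a class has at most two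
points. -/
lemma Glued.not_glued {p q r : h.holed} (hpq : h.Glued p q) (hrp : h.Glued r p) : False := by
  obtain ⟨i, z, w, h1, h2, h3, h4, h5⟩ := hpq
  obtain ⟨i', z', w', h1', h2', h3', h4', h5'⟩ := hrp
  obtain rfl : z = w' := OnePoint.coe_injective (h1.symm.trans h2')
  simpa using congrArg Prod.snd (h.eq_of_norm_sub_eq h3 h4')

/-- Points that are not on the second circle of a handle have a unique representative of this
kind. -/
lemma eq_of_mk_eq {p q : h.holed} (hp : ∀ r, ¬ h.Glued r p) (hq : ∀ r, ¬ h.Glued r q)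
    (hpq : Quot.mk h.Glued p = Quot.mk h.Glued q) : p = q := by
  classical
  -- `F` moves points of second circles to their partners on first circles; it is constant on glued
  -- pairs and hence descends to the surface.
  let F : h.holed → h.holed := fun p ↦ if H : ∃ r, h.Glued r p then H.choose else p
  have hF : ∀ p q, h.Glued p q → F p = F q := by
    intro p q hpq
    have h1 : ¬ ∃ r, h.Glued r p := fun ⟨r, hr⟩ ↦ Glued.not_glued h hpq hr
    have h2 : ∃ r, h.Glued r q := ⟨p, hpq⟩
    simp only [F, dif_neg h1, dif_pos h2]
    exact Glued.left_unique h hpq h2.choose_spec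
  have hFp : ∀ p, (∀ r, ¬ h.Glued r p) → F p = p := fun p hp ↦
    dif_neg (not_exists.2 hp)
  have := congrArg (Quot.lift F hF) hpq
  rwa [← hFp p hp, ← hFp q hq]

/-- The quotient map from the holed sphere. -/
def toSurface (q : h.holed) : h.Surface := Quot.mk h.Glued q

/-- The point `p` of the surface is represented by `z`, which is not on the second circle of a
handle. -/
def Represents (z : ℂ) (p : h.Surface) : Prop :=
  ∃ q : h.holed, h.toSurface q = p ∧ (q : OnePoint ℂ) = z ∧ ∀ r, ¬ h.Glued r q

lemma represents_mk {z : ℂ} (hz : (z : OnePoint ℂ) ∈ h.holed)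
    (hz' : ∀ i, ‖z - h.center (i, true)‖ ≠ h.radius (i, true)) :
    h.Represents z (h.toSurface ⟨z, hz⟩) := by
  refine ⟨⟨z, hz⟩, rfl, rfl, ?_⟩
  rintro r ⟨i, z', w, -, h2, -, h4, -⟩
  obtain rfl : z = w := OnePoint.coe_injective h2
  exact hz' i h4

/-- This reduces every non-crossing condition on the surface to inequalities between complex
numbers. -/
lemma Represents.eq_iff {z w : ℂ} {p q : h.Surface} (hp : h.Represents z p)
    (hq : h.Represents w q) : p = q ↔ z = w := by
  obtain ⟨p, rfl, h1, h2⟩ := hp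
  obtain ⟨q, rfl, h3, h4⟩ := hq
  constructor
  · intro hpq
    have := h.eq_of_mk_eq h2 h4 hpq
    exact OnePoint.coe_injective (by rw [← h1, ← h3, this])
  · rintro rfl
    rw [Subtype.ext (h1.trans h3.symm)]

/-- A curve in the holed sphere gives a curve in the surface. -/
lemma continuous_mk {X : Type*} [TopologicalSpace X] {f : X → ℂ} (hf : Continuous f)
    (hm : ∀ x, (f x : OnePoint ℂ) ∈ h.holed) :
    Continuous fun x ↦ h.toSurface ⟨f x, hm x⟩ :=
  continuous_quot_mk.comp ((OnePoint.continuous_coe.comp hf).subtype_mk hm)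

end Handles

namespace GridParams

variable (P : GridParams)

/-! ### A sphere with handles below the grid -/

/-- The radius of the disks to which handles are attached. -/
noncomputable def radius : ℝ := P.k / 2 - 1 / 4

/-- The center of the disk below the `p`-th group of columns. -/
noncomputable def groupCenter (p : ℕ) : ℂ := ⟨p * P.k + (P.k - 1) / 2, -P.k⟩

/-- The groups of columns above the two disks of a handle. -/
def group (k : ℕ × Bool) : ℕ := if k.2 then 2 * P.σ k.1 + 1 else 2 * k.1

lemma group_injective : Function.Injective P.group := by
  rintro ⟨i, b⟩ ⟨j, c⟩ h
  cases b <;> cases c <;> simp [group] at h ⊢ <;> grind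

lemma two_le_cast : (2 : ℝ) ≤ P.k := by exact_mod_cast P.two_le

lemma radius_pos : 0 < P.radius := by
  have := P.two_le_cast
  rw [radius]
  linarith

lemma le_norm_groupCenter_sub {p q : ℕ} (h : p ≠ q) :
    (P.k : ℝ) ≤ ‖P.groupCenter p - P.groupCenter q‖ := by
  refine le_trans ?_ (Complex.abs_re_le_norm _)
  have h1 : (1 : ℝ) ≤ |(p : ℝ) - q| := by
    have : (1 : ℤ) ≤ |(p : ℤ) - q| := Int.one_le_abs (by omega)
    exact_mod_cast this
  have h2 : (P.groupCenter p - P.groupCenter q).re = ((p : ℝ) - q) * P.k := by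
    simp only [groupCenter, Complex.sub_re]
    ring
  rw [h2, abs_mul, Nat.abs_cast]
  nlinarith [P.two_le_cast]

/-- The sphere with handles on which the grid graph is drawn. -/
noncomputable def handles (g : ℕ) : Handles g where
  center k := P.groupCenter (P.group (k.1, k.2))
  radius _ := P.radius
  radius_pos _ := P.radius_pos
  disjoint k l hkl := by
    refine Metric.closedBall_disjoint_closedBall ?_
    rw [dist_eq_norm]
    refine lt_of_lt_of_le ?_ (P.le_norm_groupCenter_sub (p := P.group (k.1, k.2))
      (q := P.group (l.1, l.2)) fun h ↦ hkl ?_)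
    -- Centers are at least `k` apart and the radius is below `k / 2`.
    · rw [radius]
      linarith
    · have := P.group_injective h
      simp only [Prod.mk.injEq, Fin.val_inj] at this
      exact Prod.ext this.1 this.2
  -- This twist glues the upper point at offset `u` on the first circle to the upper point at offset
  -- `-u` on the second.
  twist _ := -(P.radius ^ 2 : ℝ)
  norm_twist _ := by
    rw [norm_neg, Complex.norm_real, Real.norm_of_nonneg (sq_nonneg _), sq]

/-- The disks reach up only to height `-k/2 - 1/4`, which is below `-1` since `k ≥ 2`. -/
lemma lt_norm_of_neg_one_lt_im {z : ℂ} (hz : -1 < z.im) (p : ℕ) :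
    P.radius < ‖z - P.groupCenter p‖ := by
  refine lt_of_lt_of_le ?_ ((le_abs_self _).trans (Complex.abs_im_le_norm _))
  have := P.two_le_cast
  simp only [groupCenter, Complex.sub_im, radius]
  linarith

/-- The distance from the real line to the disk at horizontal distance `u` from its center. -/
noncomputable def depth (u : ℝ) : ℝ := P.k - √(P.radius ^ 2 - u ^ 2)

lemma depth_pos (u : ℝ) : 0 < P.depth u := by
  have h1 : √(P.radius ^ 2 - u ^ 2) ≤ P.radius :=
    Real.sqrt_le_iff.2 ⟨P.radius_pos.le, by nlinarith [sq_nonneg u]⟩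
  have h2 : P.radius < P.k := by
    have := P.two_le_cast
    rw [radius]
    linarith
  rw [depth]
  linarith

/-- The radius exceeds the half-width `(k - 1) / 2` of a group, so each of its columns, extended
downwards, meets the circle. -/
lemma sq_lt_radius_sq {u : ℝ} (hu : |u| ≤ (P.k - 1) / 2) : u ^ 2 < P.radius ^ 2 := by
  rw [sq_lt_sq, abs_of_pos P.radius_pos]
  refine hu.trans_lt ?_
  rw [radius]
  linarith

/-- A point on the vertical segment from the real line to the disk below. -/
noncomputable def columnPoint (p : ℕ) (u s : ℝ) : ℂ :=
  ⟨p * P.k + (P.k - 1) / 2 + u, -(P.depth u * s)⟩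

lemma lt_norm_columnPoint_of_ne {p q : ℕ} (hpq : p ≠ q) {u : ℝ} (hu : |u| ≤ (P.k - 1) / 2)
    (s : ℝ) : P.radius < ‖P.columnPoint p u s - P.groupCenter q‖ := by
  refine lt_of_lt_of_le ?_ (Complex.abs_re_le_norm _)
  have h1 : (1 : ℝ) ≤ |(p : ℝ) - q| := by
    have : (1 : ℤ) ≤ |(p : ℤ) - q| := Int.one_le_abs (by omega)
    exact_mod_cast this
  have h2 : (P.columnPoint p u s - P.groupCenter q).re = ((p : ℝ) - q) * P.k + u := by
    simp only [columnPoint, groupCenter, Complex.sub_re]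
    ring
  have h3 : |((p : ℝ) - q) * P.k| - |u| ≤ |((p : ℝ) - q) * P.k + u| := by
    simpa using abs_sub_abs_le_abs_sub (((p : ℝ) - q) * P.k) (-u)
  rw [abs_mul, Nat.abs_cast] at h3
  rw [h2, radius]
  nlinarith [P.two_le_cast]

lemma norm_columnPoint_sub_sq {p : ℕ} {u : ℝ} (hu : |u| ≤ (P.k - 1) / 2) (s : ℝ) :
    ‖P.columnPoint p u s - P.groupCenter p‖ ^ 2 =
      P.radius ^ 2 + 2 * √(P.radius ^ 2 - u ^ 2) * (P.depth u * (1 - s)) +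
        (P.depth u * (1 - s)) ^ 2 := by
  have h1 := Real.sq_sqrt (sub_nonneg.2 (P.sq_lt_radius_sq hu).le)
  rw [Complex.sq_norm, Complex.normSq_apply]
  simp only [columnPoint, groupCenter, Complex.sub_re, Complex.sub_im, depth]
  linear_combination h1

lemma le_norm_columnPoint {u s : ℝ} (hu : |u| ≤ (P.k - 1) / 2) (hs : s ≤ 1) (p q : ℕ) :
    P.radius ≤ ‖P.columnPoint p u s - P.groupCenter q‖ := by
  by_cases hpq : p = q
  · subst hpq
    refine le_of_sq_le_sq ?_ (norm_nonneg _)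
    have := mul_nonneg (P.depth_pos u).le (sub_nonneg.2 hs)
    rw [P.norm_columnPoint_sub_sq hu]
    nlinarith [Real.sqrt_nonneg (P.radius ^ 2 - u ^ 2), mul_nonneg
      (Real.sqrt_nonneg (P.radius ^ 2 - u ^ 2)) this]
  · exact (P.lt_norm_columnPoint_of_ne hpq hu s).le

lemma lt_norm_columnPoint {u s : ℝ} (hu : |u| ≤ (P.k - 1) / 2) (hs : s < 1) (p q : ℕ) :
    P.radius < ‖P.columnPoint p u s - P.groupCenter q‖ := by
  by_cases hpq : p = q
  · subst hpq
    refine lt_of_pow_lt_pow_left₀ 2 (norm_nonneg _) ?_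
    have := mul_pos (P.depth_pos u) (sub_pos.2 hs)
    rw [P.norm_columnPoint_sub_sq hu]
    nlinarith [Real.sqrt_nonneg (P.radius ^ 2 - u ^ 2), mul_nonneg
      (Real.sqrt_nonneg (P.radius ^ 2 - u ^ 2)) this.le]
  · exact P.lt_norm_columnPoint_of_ne hpq hu s

lemma norm_columnPoint_one {u : ℝ} (hu : |u| ≤ (P.k - 1) / 2) (p : ℕ) :
    ‖P.columnPoint p u 1 - P.groupCenter p‖ = P.radius := by
  refine (sq_eq_sq₀ (norm_nonneg _) P.radius_pos.le).1 ?_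
  rw [P.norm_columnPoint_sub_sq hu]
  ring

/-- With `v = √(r² - u²)`, this is `(u + iv)(-u + iv) = -(u² + v²) = -r²`. -/
lemma columnPoint_mul {u : ℝ} (hu : |u| ≤ (P.k - 1) / 2) (p q : ℕ) :
    (P.columnPoint p u 1 - P.groupCenter p) * (P.columnPoint q (-u) 1 - P.groupCenter q) =
      -(P.radius ^ 2 : ℝ) := by
  have h1 := Real.sq_sqrt (sub_nonneg.2 (P.sq_lt_radius_sq hu).le)
  apply Complex.ext
  · simp only [columnPoint, groupCenter, depth, Complex.mul_re, Complex.sub_re, Complex.sub_im,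
      Complex.neg_re, Complex.ofReal_re, neg_sq]
    linear_combination -h1
  · simp only [columnPoint, groupCenter, depth, Complex.mul_im, Complex.sub_re, Complex.sub_im,
      Complex.neg_im, Complex.ofReal_im, neg_sq]
    ring

lemma continuous_columnPoint {X : Type*} [TopologicalSpace X] (p : ℕ) (u : ℝ) {f : X → ℝ}
    (hf : Continuous f) : Continuous fun x ↦ P.columnPoint p u (f x) :=
  Complex.equivRealProdCLM.symm.continuous.comp
    (continuous_const.prodMk ((continuous_const.mul hf).neg))

/-! ### The drawing -/

/-- The position of a vertex. -/
noncomputable def vertexPoint (v : ℕ × ℕ) : ℂ := ⟨v.1, v.2⟩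

/-- The horizontal offset of the `a`-th column of a group from the center of the group. -/
noncomputable def offset (a : ℕ) : ℝ := a - (P.k - 1) / 2

/-- The curves that represent the edges; those for edges through handles jump at `1 / 2` from the
first to the second circle of the handle. -/
noncomputable def edgePoint : GridEdge → ℝ → ℂ
  | .hor x y, s => ⟨x + s, y⟩
  | .ver x y, s => ⟨x, y + s⟩
  | .top j, s => ⟨(2 * j : ℕ) + s, (P.k - 1 : ℕ) + s * (1 - s)⟩
  | .bot j, s => ⟨(2 * j : ℕ) + s, -(s * (1 - s))⟩
  | .left j, s => ⟨-(s * (1 - s)), (2 * j : ℕ) + s⟩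
  | .right j, s => ⟨(P.width - 1 : ℕ) + s * (1 - s), (2 * j : ℕ) + s⟩
  | .handle i a, s =>
    if s ≤ 1 / 2 then ⟨P.colFst i a, -(P.depth (P.offset a) * (2 * s))⟩
    else ⟨P.colSnd i a, -(P.depth (P.offset a) * (2 * (1 - s)))⟩

lemma edgePoint_zero (e : GridEdge) : P.edgePoint e 0 = vertexPoint (P.fst e) := by
  cases e <;> simp [edgePoint, vertexPoint, fst]

lemma edgePoint_one (e : GridEdge) : P.edgePoint e 1 = vertexPoint (P.snd e) := by
  cases e <;> norm_num [edgePoint, vertexPoint, snd]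

lemma edgePoint_injOn {e : GridEdge} (he : P.Valid e) {s t : ℝ}
    (h : P.edgePoint e s = P.edgePoint e t) : s = t := by
  have hre := congrArg Complex.re h
  have him := congrArg Complex.im h
  cases e
  case handle i a =>
    have hne : (P.colFst i a : ℝ) ≠ P.colSnd i a :=
      Nat.cast_injective.ne (P.colFst_ne_colSnd he.2 he.2)
    have hd := P.depth_pos (P.offset a)
    simp only [edgePoint] at hre him
    split_ifs at hre him
    · have := mul_left_cancel₀ hd.ne' (neg_injective him)
      linarith
    · exact (hne hre).elim
    · exact (hne hre.symm).elim
    · have := mul_left_cancel₀ hd.ne' (neg_injective him)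
      linarith
  all_goals
    simp only [edgePoint] at hre him
    linarith

/-- An invariant that tells apart the vertices and the interiors of the edges of the grid. -/
noncomputable def key (z : ℂ) : ℤ × ℤ × ℤ × ℤ :=
  (⌊z.re⌋, ⌈z.re⌉, max ⌊z.im⌋ (-1), max ⌈z.im⌉ 0)

/-- `κ` is the key of an interior point of an edge. -/
def HasKey : GridEdge → ℤ × ℤ × ℤ × ℤ → Prop
  | .hor x y, κ => κ = ((x : ℤ), (x : ℤ) + 1, (y : ℤ), (y : ℤ))
  | .ver x y, κ => κ = ((x : ℤ), (x : ℤ), (y : ℤ), (y : ℤ) + 1)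
  | .top j, κ => κ = (((2 * j : ℕ) : ℤ), ((2 * j : ℕ) : ℤ) + 1, ((P.k - 1 : ℕ) : ℤ), (P.k : ℤ))
  | .bot j, κ => κ = (((2 * j : ℕ) : ℤ), ((2 * j : ℕ) : ℤ) + 1, -1, 0)
  | .left j, κ => κ = (-1, 0, ((2 * j : ℕ) : ℤ), ((2 * j : ℕ) : ℤ) + 1)
  | .right j, κ =>
    κ = (((P.width - 1 : ℕ) : ℤ), (P.width : ℤ), ((2 * j : ℕ) : ℤ), ((2 * j : ℕ) : ℤ) + 1)
  | .handle i a, κ => κ = ((P.colFst i a : ℤ), (P.colFst i a : ℤ), -1, 0) ∨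
      κ = ((P.colSnd i a : ℤ), (P.colSnd i a : ℤ), -1, 0)

lemma key_vertexPoint (x y : ℕ) : key (vertexPoint (x, y)) = (↑x, ↑x, ↑y, ↑y) := by
  simp only [key, vertexPoint, Int.floor_natCast, Int.ceil_natCast]
  congr <;> omega

lemma not_hasKey_vertexPoint (e : GridEdge) (v : ℕ × ℕ) : ¬ P.HasKey e (key (vertexPoint v)) := by
  obtain ⟨x, y⟩ := v
  rw [key_vertexPoint]
  cases e <;> simp only [HasKey, Prod.mk.injEq] <;> omega

/-- Rounding down and up recovers the unit segment or cell containing an edge's interior. Below the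
axis, handle edges have integral real part and bottom edges do not; different handle edges use
different columns. -/
lemma eq_of_hasKey {e f : GridEdge} (he : P.Valid e) (hf : P.Valid f) {κ : ℤ × ℤ × ℤ × ℤ}
    (hκ : P.HasKey e κ) (hκ' : P.HasKey f κ) : e = f := by
  have hk := P.two_le
  have hw : P.k ≤ P.width := Nat.le_add_left _ _
  obtain ⟨κ₁, κ₂, κ₃, κ₄⟩ := κ
  cases e <;> cases f
  case handle.handle i a j b =>
    have h1 := P.colFst_ne_colSnd (i := i) (i' := j) he.2 hf.2
    have h2 := P.colFst_ne_colSnd (i := j) (i' := i) hf.2 he.2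
    simp only [HasKey, Prod.mk.injEq] at hκ hκ'
    rw [GridEdge.handle.injEq]
    have h3 : P.colFst i a = P.colFst j b ∨ P.colSnd i a = P.colSnd j b := by omega
    rcases h3 with h | h
    · exact P.colFst_inj he.2 hf.2 h
    · exact P.colSnd_inj he.2 hf.2 h
  all_goals
    simp only [HasKey, Prod.mk.injEq, Valid, reduceCtorEq, GridEdge.hor.injEq, GridEdge.ver.injEq,
      GridEdge.top.injEq, GridEdge.bot.injEq, GridEdge.left.injEq, GridEdge.right.injEq]
      at hκ hκ' he hf ⊢
    omega

lemma floor_natCast_add (n : ℕ) {q : ℝ} (h0 : 0 < q) (h1 : q < 1) : ⌊n + q⌋ = (n : ℤ) := by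
  rw [Int.floor_eq_iff]
  push_cast
  constructor <;> linarith

lemma ceil_natCast_add (n : ℕ) {q : ℝ} (h0 : 0 < q) (h1 : q < 1) : ⌈n + q⌉ = (n : ℤ) + 1 := by
  rw [Int.ceil_eq_iff]
  push_cast
  constructor <;> linarith

lemma floor_neg_of_lt_one {q : ℝ} (h0 : 0 < q) (h1 : q < 1) : ⌊-q⌋ = -1 := by
  rw [Int.floor_eq_iff]
  push_cast
  constructor <;> linarith

lemma ceil_neg_of_lt_one {q : ℝ} (h0 : 0 < q) (h1 : q < 1) : ⌈-q⌉ = 0 := by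
  rw [Int.ceil_eq_iff]
  push_cast
  constructor <;> linarith

lemma hasKey_edgePoint {e : GridEdge} (he : P.Valid e) {s : ℝ} (h0 : 0 < s) (h1 : s < 1) :
    P.HasKey e (key (P.edgePoint e s)) := by
  have hk := P.two_le
  have hw : P.k ≤ P.width := Nat.le_add_left _ _
  have hq0 : 0 < s * (1 - s) := mul_pos h0 (sub_pos.2 h1)
  have hq1 : s * (1 - s) < 1 := by nlinarith
  cases e
  case handle i a =>
    -- Clipping at `-1` and `0` makes the key independent of the depth below the axis.
    have hneg : ∀ r : ℝ, 0 < r → max ⌊-r⌋ (-1) = -1 ∧ max ⌈-r⌉ 0 = 0 := by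
      intro r hr
      have h2 : ⌊-r⌋ < 0 := Int.floor_lt.2 (by push_cast; linarith)
      have h3 : ⌈-r⌉ ≤ 0 := Int.ceil_le.2 (by push_cast; linarith)
      omega
    have hd := P.depth_pos (P.offset a)
    simp only [edgePoint, HasKey, key]
    split_ifs
    · have h := hneg _ (mul_pos hd (show 0 < 2 * s by linarith))
      left
      simp only [h.1, h.2, Int.floor_natCast, Int.ceil_natCast]
    · have h := hneg _ (mul_pos hd (show 0 < 2 * (1 - s) by linarith))
      right
      simp only [h.1, h.2, Int.floor_natCast, Int.ceil_natCast]
  all_goals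
    simp only [edgePoint, HasKey, key, Prod.mk.injEq, Valid, Int.floor_natCast, Int.ceil_natCast,
      floor_natCast_add _ h0 h1, ceil_natCast_add _ h0 h1, floor_natCast_add _ hq0 hq1,
      ceil_natCast_add _ hq0 hq1, floor_neg_of_lt_one hq0 hq1, ceil_neg_of_lt_one hq0 hq1,
      true_and] at he ⊢
    omega

lemma abs_offset_le {a : ℕ} (ha : a < P.k) : |P.offset a| ≤ (P.k - 1) / 2 := by
  have : (a : ℝ) + 1 ≤ P.k := by exact_mod_cast ha
  have : (0 : ℝ) ≤ a := a.cast_nonneg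
  rw [offset, abs_le]
  constructor <;> linarith

lemma mk_colFst (i a : ℕ) (s : ℝ) : (⟨P.colFst i a, -(P.depth (P.offset a) * s)⟩ : ℂ) =
    P.columnPoint (P.group (i, false)) (P.offset a) s := by
  simp only [columnPoint, colFst, offset, group, Bool.false_eq_true, if_false]
  congr 1
  push_cast
  ring

lemma mk_colSnd (i : ℕ) {a : ℕ} (ha : a < P.k) (s : ℝ) :
    (⟨P.colSnd i a, -(P.depth (P.offset a) * s)⟩ : ℂ) =
      P.columnPoint (P.group (i, true)) (-P.offset a) s := by
  have h : ((P.k - 1 - a : ℕ) : ℝ) = P.k - 1 - a := by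
    rw [Nat.cast_sub (by omega), Nat.cast_sub (by omega), Nat.cast_one]
  simp only [columnPoint, colSnd, offset, group, if_true, depth, neg_sq]
  congr 1
  push_cast
  rw [h]
  ring

lemma coe_mem_holed_iff {g : ℕ} {z : ℂ} : (z : OnePoint ℂ) ∈ (P.handles g).holed ↔
    ∀ k : Fin g × Bool, P.radius ≤ ‖z - P.groupCenter (P.group (k.1, k.2))‖ :=
  (P.handles g).coe_mem_holed

lemma represents_of_lt_norm {g : ℕ} {z : ℂ} (hz : ∀ p, P.radius < ‖z - P.groupCenter p‖) :
    (P.handles g).Represents z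
      ((P.handles g).toSurface ⟨z, P.coe_mem_holed_iff.2 fun _ ↦ (hz _).le⟩) :=
  (P.handles g).represents_mk _ fun _ ↦ (hz _).ne'

lemma exists_represents_vertexPoint (g : ℕ) (v : ℕ × ℕ) :
    ∃ p, (P.handles g).Represents (vertexPoint v) p :=
  ⟨_, P.represents_of_lt_norm (P.lt_norm_of_neg_one_lt_im (by
    simp only [vertexPoint]
    linarith [v.2.cast_nonneg (α := ℝ)]))⟩

/-- Each half descends a column to its circle and is kept there by the `min` for the rest of the
time; at time `1 / 2` the two circle points are glued, so the halves join continuously. -/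
lemma exists_curve_handle {g i a : ℕ} (hi : i < g) (ha : a < P.k) :
    ∃ γ : C(unitInterval, (P.handles g).Surface),
      ∀ s : unitInterval, (P.handles g).Represents (P.edgePoint (.handle i a) s) (γ s) := by
  have hu := P.abs_offset_le ha
  have hu' : |(-P.offset a)| ≤ (P.k - 1) / 2 := by rwa [abs_neg]
  let f : unitInterval → ℂ := fun s ↦
    P.columnPoint (P.group (i, false)) (P.offset a) (min (2 * s) 1)
  let f' : unitInterval → ℂ := fun s ↦
    P.columnPoint (P.group (i, true)) (-P.offset a) (min (2 * (1 - s)) 1)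
  have hf : ∀ s, (f s : OnePoint ℂ) ∈ (P.handles g).holed := fun s ↦
    P.coe_mem_holed_iff.2 fun _ ↦ P.le_norm_columnPoint hu (min_le_right _ _) _ _
  have hf' : ∀ s, (f' s : OnePoint ℂ) ∈ (P.handles g).holed := fun s ↦
    P.coe_mem_holed_iff.2 fun _ ↦ P.le_norm_columnPoint hu' (min_le_right _ _) _ _
  have hcf : Continuous fun s ↦ (P.handles g).toSurface ⟨f s, hf s⟩ :=
    (P.handles g).continuous_mk (P.continuous_columnPoint _ _ (by fun_prop)) hf
  have hcf' : Continuous fun s ↦ (P.handles g).toSurface ⟨f' s, hf' s⟩ :=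
    (P.handles g).continuous_mk (P.continuous_columnPoint _ _ (by fun_prop)) hf'
  refine ⟨⟨fun s ↦ if (s : ℝ) ≤ 1 / 2 then (P.handles g).toSurface ⟨f s, hf s⟩
    else (P.handles g).toSurface ⟨f' s, hf' s⟩,
    hcf.if_le hcf' continuous_subtype_val continuous_const fun s hs ↦ ?_⟩, fun s ↦ ?_⟩
  · refine Quot.sound ⟨⟨i, hi⟩, f s, f' s, rfl, rfl, ?_, ?_, ?_⟩
    · simp only [f, hs]
      norm_num
      exact P.norm_columnPoint_one hu _
    · simp only [f', hs]
      norm_num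
      exact P.norm_columnPoint_one hu' _
    · simp only [f, f', hs]
      norm_num
      exact P.columnPoint_mul hu _ _
  · dsimp only [ContinuousMap.coe_mk]
    split_ifs with hs
    · have : P.edgePoint (.handle i a) s = f s := by
        simp only [edgePoint, if_pos hs, f]
        rw [mk_colFst, min_eq_left (by linarith)]
      rw [this]
      -- The midpoint belongs to this half: it lies on a first circle, where canonical
      -- representatives are allowed.
      refine (P.handles g).represents_mk _ fun j ↦ ?_
      refine (P.lt_norm_columnPoint_of_ne (fun h ↦ ?_) hu _).ne'
      simpa using P.group_injective h
    · have : P.edgePoint (.handle i a) s = f' s := by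
        simp only [edgePoint, if_neg hs, f']
        rw [P.mk_colSnd i ha, min_eq_left (by linarith)]
      rw [this]
      -- Here the time exceeds `1 / 2`, so the second circle is not reached.
      refine (P.handles g).represents_mk _ fun j ↦ ?_
      refine (P.lt_norm_columnPoint hu' ?_ _ _).ne'
      rw [min_eq_left (by linarith)]
      linarith

lemma exists_curve {g : ℕ} (hg : P.h ≤ g) {e : GridEdge} (he : P.Valid e) :
    ∃ γ : C(unitInterval, (P.handles g).Surface),
      ∀ s : unitInterval, (P.handles g).Represents (P.edgePoint e s) (γ s) := by
  by_cases hhandle : ∃ i a, e = .handle i a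
  · obtain ⟨i, a, rfl⟩ := hhandle
    exact P.exists_curve_handle (he.1.trans_le hg) he.2
  have him : ∀ s : unitInterval, -1 < (P.edgePoint e s).im := by
    rintro ⟨s, h0, h1⟩
    have hq : 0 ≤ s * (1 - s) := mul_nonneg h0 (sub_nonneg.2 h1)
    have hq1 : s * (1 - s) < 1 := by nlinarith
    have hn : ∀ n : ℕ, (0 : ℝ) ≤ n := fun n ↦ n.cast_nonneg
    cases e
    case handle i a => exact (hhandle ⟨i, a, rfl⟩).elim
    case hor x y => simp only [edgePoint]; linarith [hn y]
    case ver x y => simp only [edgePoint]; linarith [hn y]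
    case top j => simp only [edgePoint]; linarith [hn (P.k - 1)]
    case bot j => simp only [edgePoint]; linarith
    case left j => simp only [edgePoint]; linarith [hn (2 * j)]
    case right j => simp only [edgePoint]; linarith [hn (2 * j)]
  have hcont : Continuous fun s : unitInterval ↦ P.edgePoint e s := by
    have hmk : ∀ {f f' : unitInterval → ℝ}, Continuous f → Continuous f' →
        Continuous fun s ↦ (⟨f s, f' s⟩ : ℂ) := fun hf hf' ↦
      Complex.equivRealProdCLM.symm.continuous.comp (hf.prodMk hf')
    cases e
    case handle i a => exact (hhandle ⟨i, a, rfl⟩).elim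
    all_goals exact hmk (by fun_prop) (by fun_prop)
  have h := fun s ↦ P.represents_of_lt_norm (g := g) (P.lt_norm_of_neg_one_lt_im (him s))
  exact ⟨⟨_, (P.handles g).continuous_mk hcont _⟩, h⟩

theorem embeddableOnGenus_graph {g : ℕ} (hg : P.h ≤ g) : EmbeddableOnGenus P.graph g := by
  refine ⟨(P.handles g).Surface, inferInstance, ⟨P.handles g, ⟨Homeomorph.refl _⟩⟩, ?_⟩
  choose point hpoint using P.exists_represents_vertexPoint g
  have harc : ∀ e, ∃ γ : C(unitInterval, (P.handles g).Surface), P.Valid e →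
      ∀ s : unitInterval, (P.handles g).Represents (P.edgePoint e s) (γ s) := by
    intro e
    by_cases he : P.Valid e
    · obtain ⟨γ, hγ⟩ := P.exists_curve hg he
      exact ⟨γ, fun _ ↦ hγ⟩
    · exact ⟨.const _ (point (0, 0)), fun h ↦ (he h).elim⟩
  choose arc harc using harc
  have hint : ∀ s : unitInterval, s ≠ 0 → s ≠ 1 → 0 < (s : ℝ) ∧ (s : ℝ) < 1 := fun s h0 h1 ↦
    ⟨unitInterval.pos_iff_ne_zero.2 h0, unitInterval.lt_one_iff_ne_one.2 h1⟩
  have h0 : ∀ e, P.Valid e → arc e 0 = point (P.fst e) := fun e he ↦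
    (((harc e he 0).eq_iff _ (hpoint _))).2 (P.edgePoint_zero e)
  have h1 : ∀ e, P.Valid e → arc e 1 = point (P.snd e) := fun e he ↦
    (((harc e he 1).eq_iff _ (hpoint _))).2 (P.edgePoint_one e)
  have hne : ∀ e, P.Valid e → ∀ v, ∀ s, s ≠ 0 → s ≠ 1 → arc e s ≠ point v := by
    intro e he v s hs0 hs1 h
    have hkey := P.hasKey_edgePoint he (hint s hs0 hs1).1 (hint s hs0 hs1).2
    rw [((harc e he s).eq_iff _ (hpoint v)).1 h] at hkey
    exact P.not_hasKey_vertexPoint e v hkey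
  exact ⟨{
    point := point
    arc := arc
    injOn_point := by
      rintro ⟨x, y⟩ - ⟨x', y'⟩ - h
      have := ((hpoint _).eq_iff _ (hpoint _)).1 h
      simpa [vertexPoint, Complex.ext_iff] using this
    arc_ends := fun e he ↦ ⟨_, _, P.isLink_fst_snd he, h0 e he, h1 e he⟩
    arc_simple := fun e he s t h ↦
      .inl (Subtype.ext (P.edgePoint_injOn he (((harc e he s).eq_iff _ (harc e he t)).1 h)))
    arc_ne_point := fun e he v _ s hs0 hs1 ↦ hne e he v s hs0 hs1
    arc_ne_arc := by
      intro e he f hf hef s t hs0 hs1 h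
      by_cases ht0 : t = 0
      · rw [ht0, h0 f hf] at h
        exact hne e he _ s hs0 hs1 h
      by_cases ht1 : t = 1
      · rw [ht1, h1 f hf] at h
        exact hne e he _ s hs0 hs1 h
      have hkey := P.hasKey_edgePoint he (hint s hs0 hs1).1 (hint s hs0 hs1).2
      rw [((harc e he s).eq_iff _ (harc f hf t)).1 h] at hkey
      exact hef (P.eq_of_hasKey he hf hkey
        (P.hasKey_edgePoint hf (hint t ht0 ht1).1 (hint t ht0 ht1).2)) }⟩

end GridParams

/-! ### Choice of the parameters -/

lemma expanding_one (R : ℕ → ℕ → Prop) : Expanding 1 R := by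
  intro A hA B hB hAB hA1 hB1
  have hmem : ∀ S ⊆ Finset.range 1, 1 ≤ 4 * S.card → 0 ∈ S := by
    intro S hS h1
    obtain ⟨x, hx⟩ := Finset.card_pos.1 (show 0 < S.card by omega)
    have := Finset.mem_range.1 (hS hx)
    obtain rfl : x = 0 := by omega
    exact hx
  -- With one block the condition is vacuous: two nonempty subsets of `{0}` are never disjoint.
  exact (Finset.disjoint_left.1 hAB (hmem A hA hA1) (hmem B hB hB1)).elim

/-- For each `g` there are a matching on at most `g` pairs and a partition into blocks of
consecutive numbers that give an expanding relation on a number of blocks proportional to `g`. -/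
lemma exists_expanding_params {g : ℕ} (m : ℕ) (hm : m = max 1 (g / 100)) :
    ∃ (h w : ℕ) (σ : Equiv.Perm ℕ), h ≤ g ∧ 2 * h + 1 ≤ 41 * m ∧ 0 < w ∧ w * m ≤ 2 * h + 1 ∧
      (∀ i, σ i < h ↔ i < h) ∧ Expanding m (BlockLink σ h w) := by
  by_cases hg : g < 100
  · obtain rfl : m = 1 := by omega
    exact ⟨0, 1, 1, by omega, by omega, by omega, by omega, by simp, expanding_one _⟩
  · obtain ⟨σ, hσ, hexp⟩ := exists_expanding_blockLink (m := m) (by omega)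
    exact ⟨20 * m, 40, σ, by omega, by omega, by omega, by omega, hσ, hexp⟩

lemma exists_grid_of_large {g t : ℕ} (ht : 48 * (g + 1) ≤ t)
    (hlarge : 400000 ^ 2 < (g + 1) * t) :
    ∃ P : GridParams, P.h ≤ g ∧ 12 * ((2 * P.h + 1) * P.k ^ 2) ≤ t ∧
      ∃ s ≤ treewidth P.graph, (g + 1) * t ≤ 393600 * (128 * s) ^ 2 := by
  obtain ⟨m, hm⟩ : ∃ m, m = max 1 (g / 100) := ⟨_, rfl⟩
  obtain ⟨h, w, σ, hhg, hh, hw, hwm, hσ, hexp⟩ := exists_expanding_params m hm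
  -- The factor `1968 = 12 * 41 * 4` makes `12 * (2 * h + 1) * (2 * j) ^ 2 ≤ t`, using `2 * h + 1 ≤
  -- 41 * m`.
  set j := Nat.sqrt (t / (1968 * m)) with hj
  have hm0 : 0 < m := by omega
  have ht1 : 1968 * m ≤ t := by
    by_cases hg : g < 100
    · have : (g + 1) * t ≤ 100 * t := Nat.mul_le_mul_right _ hg
      omega
    · omega
  have hj1 : 1 ≤ j := Nat.le_sqrt.2 (by rw [Nat.le_div_iff_mul_le (by omega)]; omega)
  have hjle : j * j * (1968 * m) ≤ t :=
    (Nat.le_div_iff_mul_le (by omega)).1 (Nat.sqrt_le _)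
  have hjlt : t < (j + 1) * (j + 1) * (1968 * m) :=
    (Nat.div_lt_iff_lt_mul (by omega)).1 (Nat.lt_succ_sqrt _)
  let P : GridParams := ⟨h, 2 * j, σ, by omega, even_two_mul j, hσ⟩
  have hPk : P.k = 2 * j := rfl
  have htk : t ≤ 1968 * m * (2 * j) ^ 2 := by
    refine hjlt.le.trans ?_
    rw [mul_comm]
    exact Nat.mul_le_mul_left _ (by nlinarith)
  -- Here `g + 1 ≤ 200 * m`, and `393600 = 200 * 1968`.
  have hgt : (g + 1) * t ≤ 393600 * (m * (2 * j)) ^ 2 := by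
    calc (g + 1) * t ≤ (200 * m) * (1968 * m * (2 * j) ^ 2) :=
          Nat.mul_le_mul (by omega) htk
      _ = _ := by ring
  -- This keeps `m * k / 64` positive, so that rounding down costs at most a factor 2.
  have hmk : 128 ≤ m * (2 * j) := by
    by_contra! hlt
    have := hlarge.trans_le
      (hgt.trans (Nat.mul_le_mul_left 393600 (Nat.pow_le_pow_left hlt.le 2)))
    norm_num at this
  refine ⟨P, hhg, ?_, m * (2 * j) / 64,
    P.le_treewidth_graph hm0 hw hwm hexp (by rw [hPk]; omega), hgt.trans ?_⟩
  · calc 12 * ((2 * h + 1) * (2 * j) ^ 2) ≤ 12 * (41 * m * (2 * j) ^ 2) := by gcongr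
      _ = j * j * (1968 * m) := by ring
      _ ≤ t := hjle
  · exact Nat.mul_le_mul_left _ (Nat.pow_le_pow_left (by omega) 2)

end SurfaceGraph

theorem lemma6p4 :
    ∃ c : ℝ, 0 < c ∧ ∀ g t : ℕ, 48 * (g + 1) ≤ t →
      ∃ (α β : Type) (P : Graph α β), P.vertexSet.Finite ∧ P.edgeSet.Finite ∧
        SurfaceGraph.IsRegularOfDegree P 4 ∧
        SurfaceGraph.EmbeddableOnGenus P g ∧
        (P.vertexSet.ncard : ℝ) ≤ (t : ℝ) / 12 ∧
        max 2 (c * √((g : ℝ) * t + t)) ≤ (SurfaceGraph.treewidth P : ℝ) := by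
  -- For large `(g + 1) * t` the bound needs `128 * √393600 ≤ 200000`; below the threshold `400000 ^
  -- 2` this constant gives at most 2.
  refine ⟨1 / 200000, by norm_num, fun g t ht ↦ ?_⟩
  obtain ⟨P, hg, hcard, htw⟩ : ∃ P : SurfaceGraph.GridParams, P.h ≤ g ∧
      12 * ((2 * P.h + 1) * P.k ^ 2) ≤ t ∧
      1 / 200000 * √((g : ℝ) * t + t) ≤ max 2 (SurfaceGraph.treewidth P.graph : ℝ) := by
    have hcast : (g : ℝ) * t + t = ((g + 1) * t : ℕ) := by push_cast; ring
    by_cases hlarge : 400000 ^ 2 < (g + 1) * t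
    · obtain ⟨P, hg, hcard, s, hs, hgt⟩ := SurfaceGraph.exists_grid_of_large ht hlarge
      refine ⟨P, hg, hcard, le_max_of_le_right (le_trans ?_ (Nat.cast_le.2 hs))⟩
      have hsqrt : √((g : ℝ) * t + t) ≤ 200000 * s := by
        rw [hcast, Real.sqrt_le_left (by positivity)]
        have : (((g + 1) * t : ℕ) : ℝ) ≤ (393600 * (128 * s) ^ 2 : ℕ) := Nat.cast_le.2 hgt
        push_cast at this ⊢
        nlinarith [sq_nonneg (s : ℝ)]
      linarith
    -- The two-by-two grid has four vertices, and `12 * 4 = 48 ≤ t`.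
    · refine ⟨⟨0, 2, 1, le_rfl, even_two, by simp⟩, g.zero_le, by dsimp only; omega,
        le_max_of_le_left ?_⟩
      have hsqrt : √((g : ℝ) * t + t) ≤ 400000 := by
        rw [hcast, Real.sqrt_le_left (by norm_num)]
        exact_mod_cast not_lt.1 hlarge
      linarith
  have htwo : (2 : ℝ) ≤ SurfaceGraph.treewidth P.graph := by
    exact_mod_cast P.two_le_treewidth_graph
  refine ⟨_, _, P.graph, P.finite_vertexSet, P.finite_edgeSet, P.isRegularOfDegree_graph,
    P.embeddableOnGenus_graph hg, ?_, max_le htwo (by rwa [max_eq_right htwo] at htw)⟩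
  rw [P.ncard_vertexSet, le_div_iff₀ (by norm_num), mul_comm]
  exact_mod_cast hcard
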